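/- Let $S\subseteq\mathbb R$ be countable and dense. Call a metric space an $S$-metric space if the distance between any two distinct points belongs to $S$, and view it as a structure in the relational language with one binary symbol $R_s$ for each $s\in S$, where $R_s(x,y)$ holds if and only if $d(x,y)=s$. Let $\mathcal F_S$ be the class of finite $S$-metric spaces that are isometric, for some $n$, to a subset $\{x_1,\dots,x_m\}$ of the unit sphere of $\mathbb R^n$ (with its Euclidean distance) such that $0,x_1,\dots,x_m$ are affinely independent. Then $\mathcal F_S$ is a Fraïssé class, it has a Fraïssé limit, and every Fraïssé limit $M$ of $\mathcal F_S$ is a countably infinite structure such that, with $G=\mathrm{Aut}(M)$ carrying the topology of pointwise convergence on the discrete set $M$, and $G_{\bar a}$ denoting the pointwise stabilizer in $G$ of a tuple $\bar a$: 1. $M$ is transitive: $G$ acts transitively on $M$; 2. $M$ has no algebraicity: for every finite tuple $\bar a$ of $M$ and every $x\in M$ not in $\bar a$, the orbit $G_{\bar a}\cdot x$ is infinite; 3. $M$ has weak elimination of imaginaries: for every proper open subgroup $V<G$ there is a finite tuple $\bar a$ of $M$ such that $G_{\bar a}\le V$ and $[V:G_{\bar a}]<\infty$; 4. $M$ is not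 $\aleph_0$-categorical: for some $n$, the diagonal action of $G$ on $M^n$ has infinitely many orbits; 5. $G$ is not de Finetti: there are a standard Borel space $Z$ and a probability measure $\mu$ on $Z^M$ which is invariant and ergodic for the shift action $(g\cdot x)(a)=x(g^{-1}a)$ of $G$ but is not of the form $\nu^{\otimes M}$ for any probability measure $\nu$ on $Z$. Here an invariant $\mu$ is ergodic if every measurable $A\subseteq Z^M$ with $\mu(A\,\triangle\, g\cdot A)=0$ for all $g\in G$ satisfies $\mu(A)\in\{0,1\}$. In particular, there is a transitive Fraïssé limit $M$ with no algebraicity and with weak elimination of imaginaries such that $\mathrm{Aut}(M)$ is not de Finetti. Since $M$ is not $\aleph_0$-categorical, this shows that the hypothesis of $\aleph_0$-categoricity cannot be dropped from the Jahel–Tsankov theorem (if a Fraïssé limit is $\aleph_0$-categorical, transitive, has no algebraicity and has weak elimination of imaginaries, then its automorphism group is de Finetti). -/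

import Mathlib

open MeasureTheory FirstOrder FirstOrder.Language
open scoped Topology

namespace DeFinettiGroups

section PermutationGroups

/-! Properties of a permutation group `G ≤ Sym(M)`, applied below to `G = Aut(M)`. -/

variable {M : Type} (G : Subgroup (Equiv.Perm M))

/-- The topology of pointwise convergence on a permutation group of the discrete set `M`. -/
abbrev pointwiseTopology : TopologicalSpace G :=
  TopologicalSpace.induced (fun g : G => fun x : M => g • x)
    (@Pi.topologicalSpace M (fun _ => M) (fun _ => ⊥))

/-- For every tuple `a` and every `x` not in `a`, the orbit of `x` under the pointwise
stabilizer of `a` is infinite. -/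
def NoAlgebraicity : Prop :=
  ∀ (k : ℕ) (a : Fin k → M) (x : M), x ∉ Set.range a →
    (MulAction.orbit (fixingSubgroup G (Set.range a)) x).Infinite

/-- For every `n`, the diagonal action on `n`-tuples has finitely many orbits. -/
def AlephZeroCategorical : Prop :=
  ∀ n : ℕ, Finite (MulAction.orbitRel.Quotient G (Fin n → M))

/-- Every proper open subgroup `V` contains, with finite index, the pointwise stabilizer of some
tuple. -/
def WeakEliminationOfImaginaries : Prop :=
  ∀ V : Subgroup G, V ≠ ⊤ → IsOpen[pointwiseTopology G] (V : Set G) →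
    ∃ (k : ℕ) (a : Fin k → M),
      fixingSubgroup G (Set.range a) ≤ V ∧ (fixingSubgroup G (Set.range a)).IsFiniteRelIndex V

/-- `μ` is invariant and ergodic for the shift action `(g • x) a = x (g⁻¹ • a)` on `Z ^ M`. -/
def IsShiftErgodic {Z : Type} [MeasurableSpace Z] (μ : Measure (M → Z)) : Prop :=
  letI : MulAction G (M → Z) := arrowAction
  ErgodicSMul G (M → Z) μ

/-- For every standard Borel space `Z`, the only invariant ergodic probability measures on `Z ^ M`
for the shift action are the powers of a probability measure on `Z`. -/
def IsDeFinetti : Prop :=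
  ∀ (Z : Type) [MeasurableSpace Z] [StandardBorelSpace Z]
    (μ : Measure (M → Z)) [IsProbabilityMeasure μ], IsShiftErgodic G μ →
      ∃ (ν : Measure Z) (_ : IsProbabilityMeasure ν), μ = Measure.infinitePi (fun _ : M => ν)

end PermutationGroups

/-- The automorphism group of a first-order structure, as a group of permutations. -/
def autGroup (L : FirstOrder.Language.{0, 0}) (M : Type) [L.Structure M] : Subgroup (Equiv.Perm M) where
  carrier := {σ | ∃ g : M ≃[L] M, g.toEquiv = σ}
  mul_mem' := by
    rintro _ _ ⟨g, rfl⟩ ⟨h, rfl⟩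
    exact ⟨g.comp h, rfl⟩
  one_mem' := ⟨FirstOrder.Language.Equiv.refl L M, rfl⟩
  inv_mem' := by
    rintro _ ⟨g, rfl⟩
    exact ⟨g.symm, rfl⟩

section Spheres

/-- The relation symbols: one binary symbol for every `s ∈ S`. -/
inductive DistSymbol (S : Set ℝ) : ℕ → Type
  | dist (s : S) : DistSymbol S 2

/-- The relational language of `S`-metric spaces. -/
def distLanguage (S : Set ℝ) : FirstOrder.Language.{0, 0} where
  Functions := fun _ => Empty
  Relations := DistSymbol S

instance (S : Set ℝ) : (distLanguage S).IsRelational :=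
  fun _ => inferInstanceAs (IsEmpty Empty)

/-- The binary symbol attached to `s`, to be read as "being at distance `s`". -/
def distSymbol {S : Set ℝ} (s : S) : (distLanguage S).Relations 2 := DistSymbol.dist s

/-- `N` is the structure of an `S`-metric space (a metric space in which all distances between
distinct points are in `S`) which is isometric to a subset of the unit sphere of some `ℝⁿ` that is
affinely independent together with `0`. -/
def IsSphericalSpace (S : Set ℝ) (N : Type) [(distLanguage S).Structure N] : Prop :=
  ∃ _ : MetricSpace N,
    (∀ x y : N, x ≠ y → dist x y ∈ S) ∧
    (∀ (s : S) (x y : N), Structure.RelMap (distSymbol s) ![x, y] ↔ dist x y = s) ∧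
    ∃ (n : ℕ) (f : N → EuclideanSpace ℝ (Fin n)),
      Isometry f ∧ (∀ x, f x ∈ Metric.sphere 0 1) ∧
      AffineIndependent ℝ (fun o : Option N => o.elim 0 f)

/-- The class of finite `S`-metric spaces that embed in a unit sphere as a subset which is affinely
independent together with `0`. -/
def sphericalClass (S : Set ℝ) : Set (CategoryTheory.Bundled.{0} (distLanguage S).Structure) :=
  {N | Finite N ∧ IsSphericalSpace S N}

end Spheres

end DeFinettiGroups

/-! Put `T = chordSet S`. Affine independence from `0` is linear independence, and for unit vectors
distances and inner products determine each other, so the class consists of the finite linearly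
independent systems of unit vectors with inner products in `T`. A countable generic system `v` of
this kind is built inside `ℓ²` by meeting countably many cofinal requirements
(`exists_isGenericSystem`). Genericity yields both the age and ultrahomogeneity, so `v` carries a
Fraïssé limit; that the class is Fraïssé then follows without amalgamating by hand, and by
uniqueness every countable limit is represented by such a system (`exists_isHomogeneousSystem`). The
remaining claims concern `IsHomogeneousSystem`.

The main principle: values in `T` prescribed on a finite set are attained by a point of `M` as soon
as some vector of norm less than `1` has them. The projection of `v x` to the span of finitely many
other points is such a vector, which gives no algebraicity. Pairs realize infinitely many inner
products, so there are infinitely many orbits.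

For weak elimination of imaginaries the key is that the stabilizers of `C ∪ {a}` and `C ∪ {b}`
generate that of `C` (`fixingSubgroup_le_of_insert`). Then among the finite sets whose stabilizer
lies in `V`, one of least size is invariant under `V`, which therefore permutes it.

The measure refuting the de Finetti property is the law of the centered Gaussian process with
covariance `⟪v x, v y⟫`. It is invariant because `G` preserves inner products. It is ergodic because
each linear combination has long sequences of almost orthogonal translates, whose characters are
almost uncorrelated: an invariant set correlates equally with all of them, hence with none. It is
not a product, since some covariances are nonzero. -/

namespace DeFinettiGroups

open scoped InnerProductSpace

/-! ### Projections, dual families and prescribed inner products. -/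

section InnerProductSpace

variable {E ι : Type*} [NormedAddCommGroup E] [InnerProductSpace ℝ E]

/-- The orthogonal projection of a vector to the span of a finite family is a linear combination
of the family. -/
theorem exists_sum_smul_inner_eq (v : ι → E) (D : Finset ι) (x : E) :
    ∃ c : ι → ℝ, (∀ d ∈ D, ⟪∑ i ∈ D, c i • v i, v d⟫_ℝ = ⟪x, v d⟫_ℝ) ∧
      ‖∑ i ∈ D, c i • v i‖ ≤ ‖x‖ ∧
      (x ∉ Submodule.span ℝ (v '' D) → ‖∑ i ∈ D, c i • v i‖ < ‖x‖) := by
  classical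
  let W := Submodule.span ℝ (v '' (D : Set ι))
  have : FiniteDimensional ℝ W := FiniteDimensional.span_of_finite ℝ (D.finite_toSet.image v)
  have hmem : W.starProjection x ∈ W := by simp
  obtain ⟨c₀, hc₀⟩ := (Submodule.mem_span_image_finset_iff_exists_fun ℝ).1 hmem
  obtain ⟨c, hc⟩ : ∃ c : ι → ℝ, ∑ i ∈ D, c i • v i = W.starProjection x := by
    refine ⟨fun i => if h : i ∈ D then c₀ ⟨i, h⟩ else 0, ?_⟩
    rw [← hc₀, ← Finset.sum_coe_sort]
    simp
  have key : ∀ y ∈ W, ⟪x - W.starProjection x, y⟫_ℝ = 0 := fun y hy =>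
    W.starProjection_inner_eq_zero x y hy
  have pyth : ‖x‖ ^ 2 = ‖W.starProjection x‖ ^ 2 + ‖x - W.starProjection x‖ ^ 2 := by
    have h1 := key _ hmem
    have h2 := norm_add_sq_real (x - W.starProjection x) (W.starProjection x)
    rw [h1, sub_add_cancel] at h2
    linarith
  refine ⟨c, fun d hd => ?_, ?_, fun hx => ?_⟩
  · rw [hc]
    have := key (v d) (Submodule.subset_span ⟨d, hd, rfl⟩)
    rw [inner_sub_left] at this
    linarith
  · rw [hc]
    exact abs_le_of_sq_le_sq' (by nlinarith [sq_nonneg ‖x - W.starProjection x‖])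
      (norm_nonneg _) |>.2
  · rw [hc]
    have hne : 0 < ‖x - W.starProjection x‖ := by
      rw [norm_pos_iff, sub_ne_zero]
      intro h
      exact hx (h ▸ hmem)
    exact lt_of_pow_lt_pow_left₀ 2 (norm_nonneg _) (by nlinarith)

/-- A finite linearly independent family has a biorthogonal family. -/
theorem exists_biorthogonal [DecidableEq ι] {v : ι → E} {D : Finset ι}
    (h : LinearIndepOn ℝ v (D : Set ι)) :
    ∃ w : ι → E, ∀ i ∈ D, ∀ j ∈ D, ⟪w i, v j⟫_ℝ = if i = j then 1 else 0 := by
  have key : ∀ i ∈ D, ∃ w : E, ∀ j ∈ D, ⟪w, v j⟫_ℝ = if i = j then 1 else 0 := by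
    intro i hi
    have hvi : v i ∉ Submodule.span ℝ (v '' (D.erase i : Finset ι)) := by
      have := linearIndepOn_iff_notMem_span.1 h i hi
      simpa using this
    obtain ⟨c, hc, -, hlt⟩ := exists_sum_smul_inner_eq v (D.erase i) (v i)
    -- The dual vector is the part of `v i` orthogonal to the other vectors, rescaled.
    set p := ∑ k ∈ D.erase i, c k • v k with hp
    have hpi : ⟪v i - p, p⟫_ℝ = 0 := by
      conv_lhs => rw [hp, inner_sum]
      refine Finset.sum_eq_zero fun k hk => ?_
      rw [inner_smul_right, inner_sub_left, hc k hk, sub_self, mul_zero]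
    have hne : ⟪v i - p, v i - p⟫_ℝ ≠ 0 := by
      rw [inner_self_ne_zero, sub_ne_zero]
      intro hvp
      exact (hlt hvi).ne (by rw [← hvp])
    refine ⟨(⟪v i - p, v i - p⟫_ℝ)⁻¹ • (v i - p), fun j hj => ?_⟩
    rw [real_inner_smul_left]
    split_ifs with hij
    · subst hij
      have : ⟪v i - p, v i⟫_ℝ = ⟪v i - p, v i - p⟫_ℝ := by
        rw [inner_sub_right (v i - p), hpi, sub_zero]
      rw [this, inv_mul_cancel₀ hne]
    · rw [inner_sub_left (v i) p (v j), hc j (Finset.mem_erase.2 ⟨Ne.symm hij, hj⟩), sub_self,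
        mul_zero]
  choose! w hw using key
  exact ⟨w, hw⟩

/-- The values of the inner products of a vector of norm less than `1` with a finite linearly
independent family of unit vectors can be moved into a set dense in `(-1, 1)`. -/
theorem exists_inner_mem_of_norm_lt_one {T : Set ℝ}
    (hT : ∀ r : ℝ, |r| < 1 → ∀ ε > 0, ∃ t ∈ T, |t - r| < ε) {v : ι → E} {D : Finset ι}
    (h : LinearIndepOn ℝ v (D : Set ι)) (hu : ∀ d ∈ D, ‖v d‖ = 1) {ξ : E} (hξ : ‖ξ‖ < 1)
    {ε : ℝ} (hε : 0 < ε) :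
    ∃ η : E, ‖η‖ < 1 ∧ ∀ d ∈ D, ⟪η, v d⟫_ℝ ∈ T ∧ |⟪η, v d⟫_ℝ - ⟪ξ, v d⟫_ℝ| < ε ∧
      (⟪ξ, v d⟫_ℝ ∈ T → ⟪η, v d⟫_ℝ = ⟪ξ, v d⟫_ℝ) := by
  classical
  obtain ⟨w, hw⟩ := exists_biorthogonal h
  set K : ℝ := ∑ d ∈ D, ‖w d‖ with hK
  have hK0 : 0 ≤ K := Finset.sum_nonneg fun _ _ => norm_nonneg _
  -- Changing each inner product by at most `δ` along the dual family moves `ξ` by at most `δ * K`,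
  -- which keeps its norm below `1`.
  set δ : ℝ := min ε ((1 - ‖ξ‖) / (K + 1)) with hδdef
  have hδ : 0 < δ := lt_min hε (div_pos (by linarith) (by linarith))
  have ht : ∀ d ∈ D, ∃ t ∈ T, |t - ⟪ξ, v d⟫_ℝ| < δ ∧ (⟪ξ, v d⟫_ℝ ∈ T → t = ⟪ξ, v d⟫_ℝ) := by
    intro d hd
    by_cases hmem : ⟪ξ, v d⟫_ℝ ∈ T
    · exact ⟨_, hmem, by simpa using hδ, fun _ => rfl⟩
    · have hlt : |⟪ξ, v d⟫_ℝ| < 1 := by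
        have := abs_real_inner_le_norm ξ (v d)
        rw [hu d hd, mul_one] at this
        linarith
      obtain ⟨t, htT, htd⟩ := hT _ hlt δ hδ
      exact ⟨t, htT, htd, fun h => absurd h hmem⟩
  choose! t htT htd hteq using ht
  set η : E := ξ + ∑ d ∈ D, (t d - ⟪ξ, v d⟫_ℝ) • w d with hη
  have hval : ∀ d ∈ D, ⟪η, v d⟫_ℝ = t d := by
    intro d hd
    rw [hη, inner_add_left, sum_inner, Finset.sum_eq_single d]
    · rw [real_inner_smul_left, hw d hd d hd]; simp
    · intro b hb hbd
      rw [real_inner_smul_left, hw b hb d hd, if_neg hbd, mul_zero]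
    · exact fun hd' => absurd hd hd'
  refine ⟨η, ?_, fun d hd => ?_⟩
  · have h1 : ‖∑ d ∈ D, (t d - ⟪ξ, v d⟫_ℝ) • w d‖ ≤ δ * K := by
      rw [hK, Finset.mul_sum]
      refine norm_sum_le_of_le _ fun d hd => ?_
      rw [norm_smul, Real.norm_eq_abs]
      exact mul_le_mul_of_nonneg_right (htd d hd).le (norm_nonneg _)
    have h2 : δ * K < 1 - ‖ξ‖ := by
      have h3 : δ * (K + 1) ≤ 1 - ‖ξ‖ := by
        rw [← le_div_iff₀ (by linarith)]; exact min_le_right _ _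
      nlinarith
    calc ‖η‖ ≤ ‖ξ‖ + ‖∑ d ∈ D, (t d - ⟪ξ, v d⟫_ℝ) • w d‖ := norm_add_le _ _
      _ < 1 := by linarith
  · rw [hval d hd]
    exact ⟨htT d hd, (htd d hd).trans_le (min_le_left _ _), hteq d hd⟩

/-- In an infinite-dimensional space, a vector of norm less than `1` can be replaced by a unit
vector with the same inner products with a given finite family, outside of its span. -/
theorem exists_unit_inner_eq (hE : ¬ FiniteDimensional ℝ E) (v : ι → E) (D : Finset ι)
    {η : E} (hη : ‖η‖ < 1) :
    ∃ x : E, ‖x‖ = 1 ∧ x ∉ Submodule.span ℝ (v '' D) ∧ ∀ d ∈ D, ⟪x, v d⟫_ℝ = ⟪η, v d⟫_ℝ := by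
  let W := Submodule.span ℝ (v '' (D : Set ι))
  have : FiniteDimensional ℝ W := FiniteDimensional.span_of_finite ℝ (D.finite_toSet.image v)
  have hW : Wᗮ ≠ ⊥ := by
    intro hbot
    have htop : W = ⊤ := (Submodule.orthogonal_eq_bot_iff (K := W)).1 hbot
    apply hE
    rw [htop] at this
    exact Module.finite_def.2 ((Submodule.fg_top ⊤).1 (Module.finite_def.1 this))
  obtain ⟨e, he, he0⟩ := Submodule.exists_mem_ne_zero_of_ne_bot hW
  obtain ⟨c, hc, hle, -⟩ := exists_sum_smul_inner_eq v D η
  set p := ∑ i ∈ D, c i • v i with hp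
  have hpW : p ∈ W := Submodule.sum_mem _ fun i hi =>
    Submodule.smul_mem _ _ (Submodule.subset_span ⟨i, hi, rfl⟩)
  have hpe : ∀ y ∈ W, ⟪y, e⟫_ℝ = 0 := fun y hy => (Submodule.mem_orthogonal W e).1 he y hy
  -- Chosen so that `p + r • e` has norm `1`; the component along `e` is invisible to the family and
  -- keeps the vector off its span.
  set r := √(1 - ‖p‖ ^ 2) / ‖e‖ with hr
  have hpos : 0 < 1 - ‖p‖ ^ 2 := by nlinarith [norm_nonneg p]
  have he' : 0 < ‖e‖ := norm_pos_iff.2 he0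
  have hr0 : r ≠ 0 := (div_pos (Real.sqrt_pos.2 hpos) he').ne'
  refine ⟨p + r • e, ?_, ?_, fun d hd => ?_⟩
  · have h1 : ‖p + r • e‖ ^ 2 = 1 := by
      rw [norm_add_sq_real, inner_smul_right, hpe p hpW, norm_smul, Real.norm_eq_abs, mul_pow,
        sq_abs, hr, div_pow, Real.sq_sqrt hpos.le]
      field_simp
      ring
    exact (pow_eq_one_iff_of_nonneg (norm_nonneg _) two_ne_zero).1 h1
  · intro hmem
    have h2 : r • e ∈ W := by simpa using W.sub_mem hmem hpW
    have h3 : e ∈ W := (Submodule.smul_mem_iff _ hr0).1 h2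
    exact he0 (inner_self_eq_zero.1 (hpe e h3))
  · rw [inner_add_left, hc d hd, real_inner_smul_left, real_inner_comm (v d) e,
      hpe _ (Submodule.subset_span ⟨d, hd, rfl⟩), mul_zero, add_zero]

end InnerProductSpace

/-- A linearly independent system of unit vectors with inner products in `T`, which realizes all
possible inner products in `T` with a finite subfamily. -/
structure IsGenericSystem {M H : Type*} [NormedAddCommGroup H] [InnerProductSpace ℝ H]
    (T : Set ℝ) (v : M → H) : Prop where
  dense : ∀ r : ℝ, |r| < 1 → ∀ ε > 0, ∃ t ∈ T, |t - r| < ε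
  norm_eq : ∀ x, ‖v x‖ = 1
  linearIndependent : LinearIndependent ℝ v
  inner_mem : ∀ x y, x ≠ y → ⟪v x, v y⟫_ℝ ∈ T
  exists_inner_eq : ∀ (A : Finset M) (ξ : H), ‖ξ‖ < 1 → (∀ a ∈ A, ⟪ξ, v a⟫_ℝ ∈ T) →
    ∃ x ∉ A, ∀ a ∈ A, ⟪v x, v a⟫_ℝ = ⟪ξ, v a⟫_ℝ

/-! ### Construction of a countable generic system. -/

section Existence

variable {H : Type*} [NormedAddCommGroup H] [InnerProductSpace ℝ H]

/-- A finite linearly independent system of unit vectors, indexed by natural numbers, with inner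
products in `T`. -/
structure FiniteSystem (T : Set ℝ) (H : Type*) [NormedAddCommGroup H] [InnerProductSpace ℝ H] where
  dom : Finset ℕ
  vec : ℕ → H
  norm_eq : ∀ i ∈ dom, ‖vec i‖ = 1
  linearIndepOn : LinearIndepOn ℝ vec (dom : Set ℕ)
  inner_mem : ∀ i ∈ dom, ∀ j ∈ dom, i ≠ j → ⟪vec i, vec j⟫_ℝ ∈ T

namespace FiniteSystem

variable {T : Set ℝ}

instance : Preorder (FiniteSystem T H) where
  le p q := p.dom ⊆ q.dom ∧ ∀ i ∈ p.dom, q.vec i = p.vec i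
  le_refl p := ⟨subset_rfl, fun _ _ => rfl⟩
  le_trans p q r hpq hqr :=
    ⟨hpq.1.trans hqr.1, fun i hi => (hqr.2 i (hpq.1 hi)).trans (hpq.2 i hi)⟩

/-- One-point extension: the inner products of `ξ` are first pushed into `T`, leaving those already
there, and the resulting vector is then lifted to a unit vector outside the span. -/
theorem exists_le_inner_eq (hT : ∀ r : ℝ, |r| < 1 → ∀ ε > 0, ∃ t ∈ T, |t - r| < ε)
    (hH : ¬ FiniteDimensional ℝ H) (p : FiniteSystem T H) {n : ℕ} (hn : n ∉ p.dom) {ξ : H}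
    (hξ : ‖ξ‖ < 1) :
    ∃ q : FiniteSystem T H, p ≤ q ∧ n ∈ q.dom ∧
      ∀ d ∈ p.dom, ⟪ξ, p.vec d⟫_ℝ ∈ T → ⟪q.vec n, q.vec d⟫_ℝ = ⟪ξ, p.vec d⟫_ℝ := by
  classical
  obtain ⟨η, hη, hηT⟩ :=
    exists_inner_mem_of_norm_lt_one hT p.linearIndepOn p.norm_eq hξ one_pos
  obtain ⟨x, hx1, hxs, hx⟩ := exists_unit_inner_eq hH p.vec p.dom hη
  have hne : ∀ i ∈ p.dom, i ≠ n := fun i hi h => hn (h ▸ hi)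
  have hup : ∀ i ∈ p.dom, Function.update p.vec n x i = p.vec i := fun i hi =>
    Function.update_of_ne (hne i hi) _ _
  have hupn : Function.update p.vec n x n = x := Function.update_self _ _ _
  have hxT : ∀ d ∈ p.dom, ⟪x, p.vec d⟫_ℝ ∈ T := fun d hd => by
    rw [hx d hd]; exact (hηT d hd).1
  refine ⟨⟨insert n p.dom, Function.update p.vec n x, ?_, ?_, ?_⟩, ⟨Finset.subset_insert _ _, hup⟩,
    Finset.mem_insert_self _ _, fun d hd hdT => ?_⟩
  · intro i hi
    rcases Finset.mem_insert.1 hi with rfl | hi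
    · rw [hupn, hx1]
    · rw [hup i hi, p.norm_eq i hi]
  · rw [Finset.coe_insert, linearIndepOn_insert (by simpa using hn), hupn]
    have himg : Function.update p.vec n x '' p.dom = p.vec '' p.dom :=
      Set.image_congr fun i hi => hup i hi
    refine ⟨p.linearIndepOn.congr fun i hi => (hup i hi).symm, ?_⟩
    rwa [himg]
  · intro i hi j hj hij
    rcases Finset.mem_insert.1 hi with rfl | hi' <;> rcases Finset.mem_insert.1 hj with rfl | hj'
    · exact absurd rfl hij
    · rw [hupn, hup j hj']; exact hxT j hj'
    · rw [hupn, hup i hi', real_inner_comm]; exact hxT i hi'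
    · rw [hup i hi', hup j hj']; exact p.inner_mem i hi' j hj' hij
  · change ⟪Function.update p.vec n x n, Function.update p.vec n x d⟫_ℝ = _
    rw [hupn, hup d hd, hx d hd, (hηT d hd).2.2 hdT]

theorem exists_le_subset (hT : ∀ r : ℝ, |r| < 1 → ∀ ε > 0, ∃ t ∈ T, |t - r| < ε)
    (hH : ¬ FiniteDimensional ℝ H) (p : FiniteSystem T H) (A : Finset ℕ) :
    ∃ q : FiniteSystem T H, p ≤ q ∧ A ⊆ q.dom := by
  classical
  induction A using Finset.induction_on with
  | empty => exact ⟨p, le_rfl, by simp⟩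
  | insert n A _ ih =>
    obtain ⟨q, hpq, hA⟩ := ih
    by_cases hn : n ∈ q.dom
    · exact ⟨q, hpq, Finset.insert_subset hn hA⟩
    · obtain ⟨r, hqr, hnr, -⟩ := exists_le_inner_eq hT hH q hn (ξ := 0) (by simp)
      exact ⟨r, hpq.trans hqr, Finset.insert_subset hnr (hA.trans hqr.1)⟩

end FiniteSystem

-- A Rasiowa–Sikorski argument. There is one requirement for each finite `A` and each choice of
-- values in `T` on `A`; countability of `T` makes these countably many, and the union of a chain
-- meeting all of them is generic.
open FiniteSystem in
theorem exists_isGenericSystem {T : Set ℝ} (hTc : T.Countable)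
    (hT : ∀ r : ℝ, |r| < 1 → ∀ ε > 0, ∃ t ∈ T, |t - r| < ε)
    (hH : ¬ FiniteDimensional ℝ H) : ∃ v : ℕ → H, IsGenericSystem T v := by
  classical
  have := hTc.to_subtype
  let : Encodable (Σ A : Finset ℕ, A → T) := Encodable.ofCountable _
  let 𝒟 : (Σ A : Finset ℕ, A → T) → Order.Cofinal (FiniteSystem T H) := fun i =>
    { carrier := {p | i.1 ⊆ p.dom ∧
        ((∃ ξ : H, ‖ξ‖ < 1 ∧ ∀ a : i.1, ⟪ξ, p.vec a⟫_ℝ = i.2 a) →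
          ∃ n ∈ p.dom, n ∉ i.1 ∧ ∀ a : i.1, ⟪p.vec n, p.vec a⟫_ℝ = i.2 a)}
      isCofinal := by
        intro p
        obtain ⟨q, hpq, hA⟩ := exists_le_subset hT hH p i.1
        by_cases hξ : ∃ ξ : H, ‖ξ‖ < 1 ∧ ∀ a : i.1, ⟪ξ, q.vec a⟫_ℝ = i.2 a
        · obtain ⟨ξ, hξ1, hξ⟩ := hξ
          obtain ⟨n, hn⟩ := Infinite.exists_notMem_finset q.dom
          obtain ⟨r, hqr, hnr, hr⟩ := exists_le_inner_eq hT hH q hn hξ1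
          refine ⟨r, ⟨hA.trans hqr.1, fun _ => ⟨n, hnr, fun h => hn (hA h), fun a => ?_⟩⟩,
            hpq.trans hqr⟩
          rw [hr a (hA a.2) (by rw [hξ]; exact (i.2 a).2), hξ]
        · exact ⟨q, ⟨hA, fun h => absurd h hξ⟩, hpq⟩ }
  let p₀ : FiniteSystem T H := ⟨∅, 0, by simp, by simp, by simp⟩
  let p : ℕ → FiniteSystem T H := Order.sequenceOfCofinals p₀ 𝒟
  have hmono : Monotone p := Order.sequenceOfCofinals.monotone p₀ 𝒟
  have hmeet : ∀ i, ∃ m, p m ∈ (𝒟 i).carrier := fun i =>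
    ⟨_, Order.sequenceOfCofinals.encode_mem p₀ 𝒟 i⟩
  have hdom : ∀ A : Finset ℕ, (∀ a ∈ A, ∃ m, a ∈ (p m).dom) → ∃ m, A ⊆ (p m).dom := by
    intro A
    induction A using Finset.induction_on with
    | empty => exact fun _ => ⟨0, by simp⟩
    | insert a A _ ih =>
      intro h
      obtain ⟨m, hm⟩ := h a (Finset.mem_insert_self _ _)
      obtain ⟨m', hm'⟩ := ih fun b hb => h b (Finset.mem_insert_of_mem hb)
      exact ⟨max m m', Finset.insert_subset ((hmono (le_max_left m m')).1 hm)
        (hm'.trans (hmono (le_max_right m m')).1)⟩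
  obtain ⟨t₀, ht₀, -⟩ := hT 0 (by simp) 1 one_pos
  have hall : ∀ n, ∃ m, n ∈ (p m).dom := by
    intro n
    -- The requirement for `{n}` also forces `n` into the domain; the value `t₀` plays no role.
    obtain ⟨m, hm⟩ := hmeet ⟨{n}, fun _ => ⟨t₀, ht₀⟩⟩
    exact ⟨m, hm.1 (Finset.mem_singleton_self n)⟩
  choose m hm using hall
  let v : ℕ → H := fun n => (p (m n)).vec n
  have hv : ∀ k n, n ∈ (p k).dom → v n = (p k).vec n := by
    intro k n hn
    rcases le_total k (m n) with h | h
    · exact (hmono h).2 n hn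
    · exact ((hmono h).2 n (hm n)).symm
  refine ⟨v, hT, fun n => (p (m n)).norm_eq n (hm n), ?_, ?_, ?_⟩
  · rw [← linearIndepOn_univ_iff, linearIndepOn_iff_linearIndepOn_finset]
    intro A _
    obtain ⟨k, hk⟩ := hdom A fun a _ => ⟨m a, hm a⟩
    exact ((p k).linearIndepOn.mono (by exact_mod_cast hk)).congr
      fun i hi => (hv k i (hk hi)).symm
  · intro x y hxy
    obtain ⟨k, hk⟩ := hdom {x, y} fun a _ => ⟨m a, hm a⟩
    have hx : x ∈ (p k).dom := hk (by simp)
    have hy : y ∈ (p k).dom := hk (by simp)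
    rw [hv k x hx, hv k y hy]
    exact (p k).inner_mem x hx y hy hxy
  · intro A ξ hξ hA
    obtain ⟨k, hk, hk'⟩ := hmeet ⟨A, fun a => ⟨⟪ξ, v a⟫_ℝ, hA a a.2⟩⟩
    obtain ⟨n, hn, hnA, hin⟩ := hk' ⟨ξ, hξ, fun a => by
      change _ = ⟪ξ, v a⟫_ℝ
      rw [hv k a (hk a.2)]⟩
    refine ⟨n, hnA, fun a ha => ?_⟩
    rw [hv k n hn, hv k a (hk ha)]
    refine (hin ⟨a, ha⟩).trans ?_
    rw [← hv k a (hk ha)]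

end Existence

/-! ### Extension and embedding properties of generic systems. -/

namespace IsGenericSystem

variable {M H : Type*} [NormedAddCommGroup H] [InnerProductSpace ℝ H] {T : Set ℝ} {v : M → H}

theorem exists_inner_near (hv : IsGenericSystem T v) (A : Finset M) {ξ : H} (hξ : ‖ξ‖ < 1)
    {ε : ℝ} (hε : 0 < ε) :
    ∃ x ∉ A, ∀ a ∈ A, |⟪v x, v a⟫_ℝ - ⟪ξ, v a⟫_ℝ| < ε ∧
      (⟪ξ, v a⟫_ℝ ∈ T → ⟪v x, v a⟫_ℝ = ⟪ξ, v a⟫_ℝ) := by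
  obtain ⟨η, hη, h⟩ := exists_inner_mem_of_norm_lt_one hv.dense
    (hv.linearIndependent.linearIndepOn (s := (A : Set M))) (fun d _ => hv.norm_eq d) hξ hε
  obtain ⟨x, hxA, hx⟩ := hv.exists_inner_eq A η hη fun a ha => (h a ha).1
  refine ⟨x, hxA, fun a ha => ?_⟩
  rw [hx a ha]
  exact (h a ha).2

/-- Transporting the projection of `w n` along `φ` preserves its norm, since the Gram matrices
agree, and this norm is less than `1`, so genericity applies. The coefficients `c` depend on neither
`φ` nor `ε`, which allows the induction in `exists_copy_near` to choose its tolerance before `φ`. -/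
theorem exists_extension_near (hv : IsGenericSystem T v) {E ι : Type*} [NormedAddCommGroup E]
    [InnerProductSpace ℝ E] {w : ι → E} {B : Finset ι} {n : ι} (hn : ‖w n‖ = 1)
    (hnB : w n ∉ Submodule.span ℝ (w '' B)) (hnT : ∀ b ∈ B, ⟪w n, w b⟫_ℝ ∈ T) :
    ∃ c : ι → ℝ, ∀ φ : ι → M, (∀ i ∈ B, ∀ j ∈ B, ⟪v (φ i), v (φ j)⟫_ℝ = ⟪w i, w j⟫_ℝ) →
      ∀ (A : Finset M) (ε : ℝ), 0 < ε → ∃ x, x ∉ A ∧ (∀ b ∈ B, x ≠ φ b) ∧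
        (∀ b ∈ B, ⟪v x, v (φ b)⟫_ℝ = ⟪w n, w b⟫_ℝ) ∧
        ∀ a ∈ A, |⟪v x, v a⟫_ℝ - ∑ b ∈ B, c b * ⟪v (φ b), v a⟫_ℝ| < ε := by
  classical
  obtain ⟨c, hc, -, hlt⟩ := exists_sum_smul_inner_eq w B (w n)
  refine ⟨c, fun φ hφ A ε hε => ?_⟩
  have hin : ∀ b ∈ B, ⟪∑ i ∈ B, c i • v (φ i), v (φ b)⟫_ℝ = ⟪w n, w b⟫_ℝ := by
    intro b hb
    rw [← hc b hb, sum_inner, sum_inner]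
    refine Finset.sum_congr rfl fun i hi => ?_
    rw [real_inner_smul_left, real_inner_smul_left, hφ i hi b hb]
  have hξ : ‖∑ i ∈ B, c i • v (φ i)‖ < 1 := by
    have : ‖∑ i ∈ B, c i • v (φ i)‖ ^ 2 = ‖∑ i ∈ B, c i • w i‖ ^ 2 := by
      rw [← real_inner_self_eq_norm_sq, ← real_inner_self_eq_norm_sq, inner_sum, inner_sum]
      refine Finset.sum_congr rfl fun i hi => ?_
      rw [real_inner_smul_right, real_inner_smul_right, hin i hi, hc i hi]
    have h2 := hlt hnB
    rw [hn] at h2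
    rw [(sq_eq_sq₀ (norm_nonneg _) (norm_nonneg _)).1 this]
    exact h2
  obtain ⟨x, hxA, hx⟩ := hv.exists_inner_near (A ∪ B.image φ) hξ hε
  refine ⟨x, fun h => hxA (Finset.mem_union_left _ h),
    fun b hb h => hxA (Finset.mem_union_right _ (h ▸ Finset.mem_image_of_mem φ hb)),
    fun b hb => ?_, fun a ha => ?_⟩
  · rw [(hx (φ b) (Finset.mem_union_right _ (Finset.mem_image_of_mem φ hb))).2, hin b hb]
    rw [hin b hb]
    exact hnT b hb
  · have := (hx a (Finset.mem_union_left _ ha)).1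
    rw [sum_inner] at this
    simpa only [real_inner_smul_left] using this

/-- A generic system contains a copy of every finite system, almost orthogonal to a given finite
subset. -/
theorem exists_copy_near (hv : IsGenericSystem T v) {E ι : Type*} [NormedAddCommGroup E]
    [InnerProductSpace ℝ E] {w : ι → E} (hw : LinearIndependent ℝ w) (hw1 : ∀ i, ‖w i‖ = 1)
    (hwT : ∀ i j, i ≠ j → ⟪w i, w j⟫_ℝ ∈ T) (A : Finset M) (B : Finset ι) (ε : ℝ) (hε : 0 < ε) :
    ∃ φ : ι → M, Set.InjOn φ B ∧ (∀ i ∈ B, ∀ j ∈ B, ⟪v (φ i), v (φ j)⟫_ℝ = ⟪w i, w j⟫_ℝ) ∧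
      ∀ b ∈ B, φ b ∉ A ∧ ∀ a ∈ A, |⟪v (φ b), v a⟫_ℝ| < ε := by
  classical
  induction B using Finset.induction_on generalizing ε with
  | empty =>
    obtain ⟨x, -⟩ := hv.exists_inner_near ∅ (ξ := 0) (by simp) one_pos
    exact ⟨fun _ => x, by simp⟩
  | insert n B hnB ih =>
    have hnE : w n ∉ Submodule.span ℝ (w '' B) := by
      have := (linearIndepOn_insert (by simpa using hnB)).1
        (hw.linearIndepOn (s := insert n (B : Set ι)))
      exact this.2
    obtain ⟨c, hc⟩ := hv.exists_extension_near (hw1 n) hnE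
      fun b hb => hwT n b fun h => hnB (by rwa [h])
    set K := ∑ b ∈ B, |c b| with hK
    have hK0 : 0 ≤ K := Finset.sum_nonneg fun _ _ => abs_nonneg _
    -- The new point inherits an error of at most `δ * K ≤ ε / 2` from the old ones, plus `ε / 2` of
    -- its own.
    set δ := min ε (ε / (2 * (K + 1))) with hδ
    have hδ0 : 0 < δ := lt_min hε (by positivity)
    have hδK : δ * K ≤ ε / 2 := by
      have h1 : δ * (2 * (K + 1)) ≤ ε := by
        rw [← le_div_iff₀ (by positivity)]; exact min_le_right _ _
      nlinarith
    obtain ⟨φ, hinj, hφ, hφA⟩ := ih δ hδ0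
    obtain ⟨x, hxA, hxφ, hx, hxa⟩ := hc φ hφ A (ε / 2) (by positivity)
    have hup : ∀ i ∈ B, Function.update φ n x i = φ i := fun i hi =>
      Function.update_of_ne (by rintro rfl; exact hnB hi) _ _
    have hupn : Function.update φ n x n = x := Function.update_self _ _ _
    refine ⟨Function.update φ n x, ?_, ?_, ?_⟩
    · intro i hi j hj hij
      rcases Finset.mem_insert.1 hi with rfl | hi' <;> rcases Finset.mem_insert.1 hj with rfl | hj'
      · rfl
      · rw [hupn, hup j hj'] at hij
        exact absurd hij (hxφ j hj')
      · rw [hupn, hup i hi'] at hij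
        exact absurd hij.symm (hxφ i hi')
      · rw [hup i hi', hup j hj'] at hij
        exact hinj hi' hj' hij
    · intro i hi j hj
      rcases Finset.mem_insert.1 hi with rfl | hi' <;> rcases Finset.mem_insert.1 hj with rfl | hj'
      · rw [hupn, real_inner_self_eq_norm_sq, real_inner_self_eq_norm_sq, hv.norm_eq, hw1]
      · rw [hupn, hup j hj', hx j hj']
      · rw [hupn, hup i hi', real_inner_comm, hx i hi', real_inner_comm]
      · rw [hup i hi', hup j hj', hφ i hi' j hj']
    · intro b hb
      rcases Finset.mem_insert.1 hb with rfl | hb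
      · rw [hupn]
        refine ⟨hxA, fun a ha => ?_⟩
        have h1 : |∑ b ∈ B, c b * ⟪v (φ b), v a⟫_ℝ| ≤ δ * K := by
          rw [hK, Finset.mul_sum]
          refine (Finset.abs_sum_le_sum_abs _ _).trans (Finset.sum_le_sum fun b hb => ?_)
          rw [abs_mul, mul_comm]
          exact mul_le_mul_of_nonneg_right ((hφA b hb).2 a ha).le (abs_nonneg _)
        have h2 := abs_sub_abs_le_abs_sub ⟪v x, v a⟫_ℝ (∑ b ∈ B, c b * ⟪v (φ b), v a⟫_ℝ)
        linarith [hxa a ha]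
      · rw [hup b hb]
        exact ⟨(hφA b hb).1, fun a ha => ((hφA b hb).2 a ha).trans_le (min_le_left _ _)⟩

end IsGenericSystem

end DeFinettiGroups

/-! ### Translation between spherical spaces and systems of unit vectors. -/

namespace DeFinettiGroups

open scoped InnerProductSpace

/-- The inner products of unit vectors at a distance in `S`, other than `1` and `-1`. -/
def chordSet (S : Set ℝ) : Set ℝ := {t | |t| < 1 ∧ √(2 - 2 * t) ∈ S}

theorem chordSet_countable {S : Set ℝ} (hS : S.Countable) : (chordSet S).Countable := by
  refine Set.MapsTo.countable_of_injOn (f := fun t => √(2 - 2 * t)) (t := S) (fun t ht => ht.2)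
    (fun a ha b hb hab => ?_) hS
  have h1 := abs_lt.1 ha.1
  have h2 := abs_lt.1 hb.1
  have := (Real.sqrt_inj (by linarith) (by linarith)).1 hab
  linarith

theorem chordSet_dense {S : Set ℝ} (hS : Dense S) (r : ℝ) (hr : |r| < 1) (ε : ℝ) (hε : 0 < ε) :
    ∃ t ∈ chordSet S, |t - r| < ε := by
  have h1 := abs_lt.1 hr
  let s₀ := √(2 - 2 * r)
  have hs₀ : 0 < s₀ := Real.sqrt_pos.2 (by linarith)
  have hs₀r : 1 - s₀ ^ 2 / 2 = r := by
    simp only [s₀]; rw [Real.sq_sqrt (by linarith)]; ring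
  have hcont : Continuous fun s : ℝ => 1 - s ^ 2 / 2 := by fun_prop
  let U : Set ℝ := {s | 0 < s ∧ |1 - s ^ 2 / 2| < 1 ∧ |1 - s ^ 2 / 2 - r| < ε}
  have hU : IsOpen U := by
    have h1 : Continuous fun s : ℝ => |1 - s ^ 2 / 2| := by fun_prop
    have h2 : Continuous fun s : ℝ => |1 - s ^ 2 / 2 - r| := by fun_prop
    exact (isOpen_lt continuous_const continuous_id).inter
      ((isOpen_lt h1 continuous_const).inter (isOpen_lt h2 continuous_const))
  obtain ⟨s, hsS, hs0, hs1, hs2⟩ := hS.exists_mem_open hU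
    ⟨s₀, hs₀, by rw [hs₀r]; exact hr, by rw [hs₀r]; simpa using hε⟩
  refine ⟨_, ⟨hs1, ?_⟩, hs2⟩
  have : 2 - 2 * (1 - s ^ 2 / 2) = s ^ 2 := by ring
  rw [this, Real.sqrt_sq hs0.le]
  exact hsS

section Systems

variable {E F : Type*} [NormedAddCommGroup E] [InnerProductSpace ℝ E]
  [NormedAddCommGroup F] [InnerProductSpace ℝ F]

theorem norm_sub_eq_sqrt_of_norm_eq_one {x y : E} (hx : ‖x‖ = 1) (hy : ‖y‖ = 1) :
    ‖x - y‖ = √(2 - 2 * ⟪x, y⟫_ℝ) := by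
  rw [← Real.sqrt_sq (norm_nonneg (x - y)), norm_sub_sq_real, hx, hy]
  congr 1
  ring

theorem norm_sub_eq_norm_sub_iff {x y : E} {x' y' : F} (hx : ‖x‖ = 1) (hy : ‖y‖ = 1)
    (hx' : ‖x'‖ = 1) (hy' : ‖y'‖ = 1) : ‖x - y‖ = ‖x' - y'‖ ↔ ⟪x, y⟫_ℝ = ⟪x', y'⟫_ℝ := by
  have h1 := real_inner_le_norm x y
  have h2 := real_inner_le_norm x' y'
  rw [hx, hy] at h1
  rw [hx', hy'] at h2
  rw [norm_sub_eq_sqrt_of_norm_eq_one hx hy, norm_sub_eq_sqrt_of_norm_eq_one hx' hy',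
    Real.sqrt_inj (by linarith) (by linarith)]
  constructor <;> intro h <;> linarith

/-- Equality would make `w x - ⟪w x, w y⟫ • w y`, of squared norm `1 - ⟪w x, w y⟫ ^ 2`, vanish. -/
theorem abs_inner_lt_one_of_linearIndependent {ι : Type*} {w : ι → E}
    (hw : LinearIndependent ℝ w) (hw1 : ∀ i, ‖w i‖ = 1) {x y : ι} (hxy : x ≠ y) :
    |⟪w x, w y⟫_ℝ| < 1 := by
  have hle := abs_real_inner_le_norm (w x) (w y)
  rw [hw1, hw1, mul_one] at hle
  refine lt_of_le_of_ne hle fun h => ?_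
  have hsq : ⟪w x, w y⟫_ℝ ^ 2 = 1 := by rw [← sq_abs, h, one_pow]
  have h0 : w x - ⟪w x, w y⟫_ℝ • w y = 0 := by
    rw [← norm_eq_zero, ← sq_eq_zero_iff, norm_sub_sq_real, inner_smul_right, norm_smul, mul_pow,
      hw1, hw1, Real.norm_eq_abs, sq_abs]
    linarith
  have h1 := (LinearIndepOn.pair_iff w hxy).1 (hw.linearIndepOn _) 1 (-⟪w x, w y⟫_ℝ)
    (by rw [one_smul, neg_smul, ← sub_eq_add_neg, h0])
  exact one_ne_zero h1.1

/-- A representation of a structure by linearly independent unit vectors with distances in `S`. -/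
structure IsSphericalSystem {S : Set ℝ} {N : Type} [(distLanguage S).Structure N]
    (w : N → E) : Prop where
  norm_eq : ∀ x, ‖w x‖ = 1
  linearIndependent : LinearIndependent ℝ w
  norm_sub_mem : ∀ x y, x ≠ y → ‖w x - w y‖ ∈ S
  relMap_iff : ∀ (s : S) (x y : N), Structure.RelMap (distSymbol s) ![x, y] ↔ ‖w x - w y‖ = s

theorem affineIndependent_option_elim_iff {N : Type*} (f : N → E) :
    AffineIndependent ℝ (fun o : Option N => o.elim 0 f) ↔ LinearIndependent ℝ f := by
  rw [affineIndependent_iff_linearIndependent_vsub ℝ _ none]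
  let e : N ≃ {o : Option N // o ≠ none} :=
    { toFun := fun x => ⟨some x, by simp⟩
      invFun := fun o => o.1.get (Option.ne_none_iff_isSome.1 o.2)
      left_inv := fun x => by simp
      right_inv := fun o => by simp }
  rw [← linearIndependent_equiv e]
  congr! 1
  ext x
  simp [e]

variable {S : Set ℝ} {N M : Type} [(distLanguage S).Structure N] [(distLanguage S).Structure M]

theorem IsSphericalSpace.exists_isSphericalSystem (h : IsSphericalSpace S N) :
    ∃ (n : ℕ) (w : N → EuclideanSpace ℝ (Fin n)), IsSphericalSystem (S := S) w := by
  obtain ⟨_, hS, hrel, n, f, hf, hf1, hfi⟩ := h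
  have hd : ∀ x y, ‖f x - f y‖ = dist x y := fun x y => by rw [← dist_eq_norm, hf.dist_eq]
  exact ⟨n, f, by simpa using hf1, (affineIndependent_option_elim_iff f).1 hfi,
    fun x y hxy => by rw [hd]; exact hS x y hxy, fun s x y => by rw [hd]; exact hrel s x y⟩

namespace IsSphericalSystem

/-- The span of finitely many vectors is isometric to some `ℝⁿ`, so the ambient space may be
infinite-dimensional. -/
theorem isSphericalSpace [Finite N] {w : N → E} (hw : IsSphericalSystem (S := S) w) :
    IsSphericalSpace S N := by
  let W := Submodule.span ℝ (Set.range w)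
  have : FiniteDimensional ℝ W := FiniteDimensional.span_of_finite ℝ (Set.finite_range w)
  let b := stdOrthonormalBasis ℝ W
  let w' : N → W := fun x => ⟨w x, Submodule.subset_span ⟨x, rfl⟩⟩
  let f : N → EuclideanSpace ℝ (Fin (Module.finrank ℝ W)) := fun x => b.repr (w' x)
  have hf : ∀ x y, ‖f x - f y‖ = ‖w x - w y‖ := fun x y => by
    simp only [f, ← map_sub, LinearIsometryEquiv.norm_map]; rfl
  let _ : MetricSpace N := MetricSpace.induced w hw.linearIndependent.injective inferInstance
  have hd : ∀ x y : N, dist x y = ‖w x - w y‖ := fun x y => dist_eq_norm (w x) (w y)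
  refine ⟨inferInstance, fun x y hxy => by rw [hd]; exact hw.norm_sub_mem x y hxy,
    fun s x y => by rw [hd]; exact hw.relMap_iff s x y, _, f, ?_, ?_, ?_⟩
  · exact Isometry.of_dist_eq fun x y => by rw [hd, dist_eq_norm, hf]
  · intro x
    rw [mem_sphere_zero_iff_norm]
    simp only [f, LinearIsometryEquiv.norm_map]
    exact hw.norm_eq x
  · rw [affineIndependent_option_elim_iff]
    have h1 : LinearIndependent ℝ w' :=
      LinearIndependent.of_comp W.subtype (by exact hw.linearIndependent)
    exact h1.map' b.repr.toLinearEquiv.toLinearMap (LinearEquiv.ker _)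

theorem inner_mem {w : N → E} (hw : IsSphericalSystem (S := S) w) (x y : N) (hxy : x ≠ y) :
    ⟪w x, w y⟫_ℝ ∈ chordSet S :=
  ⟨abs_inner_lt_one_of_linearIndependent hw.linearIndependent hw.norm_eq hxy, by
    rw [← norm_sub_eq_sqrt_of_norm_eq_one (hw.norm_eq x) (hw.norm_eq y)]
    exact hw.norm_sub_mem x y hxy⟩

theorem inner_map_eq {w : N → E} {v : M → F} (hw : IsSphericalSystem (S := S) w)
    (hv : IsSphericalSystem (S := S) v) (f : N ↪[distLanguage S] M) (x y : N) :
    ⟪v (f x), v (f y)⟫_ℝ = ⟪w x, w y⟫_ℝ := by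
  by_cases hxy : x = y
  · rw [hxy, real_inner_self_eq_norm_sq, real_inner_self_eq_norm_sq, hv.norm_eq, hw.norm_eq]
  · rw [← norm_sub_eq_norm_sub_iff (hv.norm_eq _) (hv.norm_eq _) (hw.norm_eq _) (hw.norm_eq _)]
    have h1 := (hw.relMap_iff ⟨_, hw.norm_sub_mem x y hxy⟩ x y).2 rfl
    rw [← f.map_rel] at h1
    have h2 : f ∘ ![x, y] = ![f x, f y] := by
      ext i; fin_cases i <;> rfl
    rw [h2] at h1
    exact (hv.relMap_iff _ _ _).1 h1

theorem exists_embedding {w : N → E} {v : M → F} (hw : IsSphericalSystem (S := S) w)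
    (hv : IsSphericalSystem (S := S) v) (φ : N → M)
    (hφ : ∀ x y, ⟪v (φ x), v (φ y)⟫_ℝ = ⟪w x, w y⟫_ℝ) :
    ∃ f : N ↪[distLanguage S] M, ∀ x, f x = φ x := by
  have hinj : Function.Injective φ := by
    intro x y hxy
    by_contra hne
    have h1 := (hw.inner_mem x y hne).1
    rw [← hφ, hxy, real_inner_self_eq_norm_sq, hv.norm_eq] at h1
    simp at h1
  refine ⟨{ toFun := φ, inj' := hinj, map_fun' := fun f => isEmptyElim f, map_rel' := ?_ },
    fun _ => rfl⟩
  rintro _ ⟨s⟩ x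
  have h2 : x = ![x 0, x 1] := by ext i; fin_cases i <;> rfl
  have h3 : φ ∘ x = ![φ (x 0), φ (x 1)] := by ext i; fin_cases i <;> rfl
  change Structure.RelMap (distSymbol s) (φ ∘ x) ↔ Structure.RelMap (distSymbol s) x
  rw [h3, h2]
  refine (hv.relMap_iff _ _ _).trans (Iff.trans ?_ (hw.relMap_iff _ _ _).symm)
  rw [(norm_sub_eq_norm_sub_iff (hv.norm_eq _) (hv.norm_eq _) (hw.norm_eq _) (hw.norm_eq _)).2
    (hφ _ _)]
  rfl

theorem comp_embedding {v : M → F} (hv : IsSphericalSystem (S := S) v)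
    (f : N ↪[distLanguage S] M) : IsSphericalSystem (S := S) (v ∘ f) where
  norm_eq x := hv.norm_eq _
  linearIndependent := hv.linearIndependent.comp f f.injective
  norm_sub_mem x y hxy := hv.norm_sub_mem _ _ fun h => hxy (f.injective h)
  relMap_iff s x y := by
    have h2 : f ∘ ![x, y] = ![f x, f y] := by
      ext i; fin_cases i <;> rfl
    rw [← f.map_rel, h2]
    exact hv.relMap_iff s _ _

end IsSphericalSystem

end Systems

/-- A generic system together with its group of isometries, which acts homogeneously. -/
structure IsHomogeneousSystem {M H : Type*} [NormedAddCommGroup H] [InnerProductSpace ℝ H]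
    (T : Set ℝ) (v : M → H) (G : Subgroup (Equiv.Perm M)) : Prop extends IsGenericSystem T v where
  mem_iff : ∀ σ : Equiv.Perm M, σ ∈ G ↔ ∀ x y, ⟪v (σ x), v (σ y)⟫_ℝ = ⟪v x, v y⟫_ℝ
  exists_perm : ∀ (A : Finset M) (φ : M → M),
    (∀ a ∈ A, ∀ b ∈ A, ⟪v (φ a), v (φ b)⟫_ℝ = ⟪v a, v b⟫_ℝ) → ∃ g ∈ G, ∀ a ∈ A, g a = φ a

/-! ### Generic systems as Fraïssé limits. -/

section Limits

variable {S : Set ℝ} {H : Type*} [NormedAddCommGroup H] [InnerProductSpace ℝ H]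
  {M : Type} [(distLanguage S).Structure M]

theorem mem_autGroup_iff {v : M → H} (hv : IsSphericalSystem (S := S) v) (σ : Equiv.Perm M) :
    σ ∈ autGroup (distLanguage S) M ↔ ∀ x y, ⟪v (σ x), v (σ y)⟫_ℝ = ⟪v x, v y⟫_ℝ := by
  constructor
  · rintro ⟨g, rfl⟩ x y
    exact hv.inner_map_eq hv g.toEmbedding x y
  · intro h
    obtain ⟨f, hf⟩ := hv.exists_embedding hv σ h
    refine ⟨{ σ with map_fun' := fun f => isEmptyElim f, map_rel' := fun r x => ?_ }, rfl⟩
    have h1 : σ ∘ x = f ∘ x := by ext i; simp [hf]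
    change Structure.RelMap r (σ ∘ x) ↔ _
    rw [h1]
    exact f.map_rel r x

/-- Since the structure is countable, ultrahomogeneity reduces to extending a finite partial
embedding by one point, which is `exists_extension_near`; the age comes from `exists_copy_near`. -/
theorem IsGenericSystem.isFraisseLimit [Countable M] {v : M → H}
    (hg : IsGenericSystem (chordSet S) v) (hv : IsSphericalSystem (S := S) v) :
    IsFraisseLimit (sphericalClass S) M where
  ultrahomogeneous := by
    classical
    rw [isUltrahomogeneous_iff_IsExtensionPair Structure.cg_of_countable,
      isExtensionPair_iff_exists_embedding_closure_singleton_sup]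
    intro A hA f m
    have hAfin : (A : Set M).Finite := by
      have : Finite A := hA.finite
      exact Set.toFinite _
    have hfi : ∀ a b : A, ⟪v (f a), v (f b)⟫_ℝ = ⟪v a, v b⟫_ℝ :=
      (hv.comp_embedding (Substructure.subtype A)).inner_map_eq hv f
    by_cases hm : m ∈ A
    · have hle : Substructure.closure (distLanguage S) {m} ⊔ A ≤ A :=
        sup_le (Substructure.closure_le.2 (by simpa using hm)) le_rfl
      exact ⟨f.comp (Substructure.inclusion hle), by ext; rfl⟩
    · have hmS : v m ∉ Submodule.span ℝ (v '' (hAfin.toFinset : Set M)) := by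
        have := (linearIndepOn_insert (s := (A : Set M)) (f := v) (by simpa using hm)).1
          (hg.linearIndependent.linearIndepOn _)
        simpa using this.2
      obtain ⟨c, hc⟩ := hg.exists_extension_near (hg.norm_eq m) hmS fun b hb =>
        hg.inner_mem m b (by rintro rfl; exact hm (by simpa using hb))
      let φ : M → M := fun x => if h : x ∈ A then f ⟨x, h⟩ else x
      have hφ : ∀ a (h : a ∈ A), φ a = f ⟨a, h⟩ := fun a h => dif_pos h
      obtain ⟨x, -, -, hx, -⟩ := hc φ (fun i hi j hj => by
        rw [hφ i (by simpa using hi), hφ j (by simpa using hj), hfi]) ∅ 1 one_pos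
      let ψ : M → M := fun y => if y = m then x else φ y
      have hψm : ψ m = x := if_pos rfl
      have hψ : ∀ a (h : a ∈ A), ψ a = f ⟨a, h⟩ := fun a h => by
        rw [← hφ a h]; exact if_neg (by rintro rfl; exact hm h)
      let B : (distLanguage S).Substructure M := Substructure.closure (distLanguage S) {m} ⊔ A
      have hB : ∀ y ∈ B, y = m ∨ y ∈ A := by
        intro y hy
        have h1 : B ≤ Substructure.closure (distLanguage S) ({m} ∪ (A : Set M)) := by
          rw [Substructure.closure_union, Substructure.closure_eq]
        have := h1 hy
        simpa using this
      have hx' : ∀ a (h : a ∈ A), ⟪v x, v (f ⟨a, h⟩)⟫_ℝ = ⟪v m, v a⟫_ℝ := fun a h => by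
        rw [← hx a (by simpa using h), hφ a h]
      obtain ⟨g, hg'⟩ := (hv.comp_embedding (Substructure.subtype B)).exists_embedding hv
        (fun y => ψ y) (by
          rintro ⟨y, hy⟩ ⟨z, hz⟩
          simp only [Function.comp, Substructure.coe_subtype]
          rcases hB y hy with rfl | hyA <;> rcases hB z hz with rfl | hzA
          · rw [real_inner_self_eq_norm_sq, real_inner_self_eq_norm_sq, hg.norm_eq, hg.norm_eq]
          · rw [hψm, hψ z hzA, hx']
          · rw [hψm, hψ y hyA, real_inner_comm, hx', real_inner_comm]
          · rw [hψ y hyA, hψ z hzA, hfi])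
      refine ⟨g, ?_⟩
      ext a
      rw [Embedding.comp_apply, hg', Substructure.coe_inclusion]
      exact (hψ a.1 a.2).symm
  age := by
    ext N
    constructor
    · rintro ⟨hN, ⟨f⟩⟩
      have : Finite N := hN.finite
      exact ⟨this, (hv.comp_embedding f).isSphericalSpace⟩
    · rintro ⟨hN, hsph⟩
      obtain ⟨n, w, hw⟩ := hsph.exists_isSphericalSystem
      have := Fintype.ofFinite N
      obtain ⟨φ, -, hφ, -⟩ := hg.exists_copy_near hw.linearIndependent hw.norm_eq hw.inner_mem ∅
        Finset.univ 1 one_pos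
      obtain ⟨f, -⟩ := hw.exists_embedding hv φ fun x y => hφ x (by simp) y (by simp)
      exact ⟨Structure.fg_iff_finite.2 hN, ⟨f⟩⟩

theorem IsGenericSystem.isHomogeneousSystem [Countable M] {v : M → H}
    (hg : IsGenericSystem (chordSet S) v) (hv : IsSphericalSystem (S := S) v) :
    IsHomogeneousSystem (chordSet S) v (autGroup (distLanguage S) M) where
  toIsGenericSystem := hg
  mem_iff := mem_autGroup_iff hv
  exists_perm A φ hφ := by
    let B : (distLanguage S).Substructure M := Substructure.closure (distLanguage S) A
    have hB : ∀ y : B, (y : M) ∈ A := fun y => by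
      have h1 : (y : M) ∈ Substructure.closure (distLanguage S) (A : Set M) := y.2
      rwa [Substructure.mem_closure_iff_of_isRelational] at h1
    obtain ⟨f, hf⟩ := (hv.comp_embedding (Substructure.subtype B)).exists_embedding hv
      (fun y => φ y) fun x y => hφ x (hB x) y (hB y)
    obtain ⟨g, hg⟩ := (hg.isFraisseLimit hv).ultrahomogeneous B
      (Substructure.fg_closure A.finite_toSet) f
    refine ⟨g.toEquiv, ⟨g, rfl⟩, fun a ha => ?_⟩
    have haB : a ∈ B := Substructure.subset_closure ha
    rw [← hf ⟨a, haB⟩, hg]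
    rfl

/-- The structure with the distances of a family of vectors. -/
@[reducible]
def structureOfFamily (S : Set ℝ) {M : Type} (v : M → H) : (distLanguage S).Structure M where
  funMap f := isEmptyElim f
  RelMap r x := match r, x with
    | DistSymbol.dist s, x => ‖v (x 0) - v (x 1)‖ = s

theorem exists_isFraisseLimit (hS : Dense S) (hSc : S.Countable) :
    ∃ (_ : (distLanguage S).Structure ℕ) (v : ℕ → lp (fun _ : ℕ => ℝ) 2),
      IsSphericalSystem (S := S) v ∧ IsGenericSystem (chordSet S) v := by
  have hfin : ¬ FiniteDimensional ℝ (lp (fun _ : ℕ => ℝ) 2) := by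
    intro h
    have hli : LinearIndependent ℝ fun i : ℕ =>
        (lp.single 2 i (1 : ℝ) : lp (fun _ : ℕ => ℝ) 2) := by
      refine Orthonormal.linearIndependent ⟨fun i => by simp [lp.norm_single], fun i j hij => ?_⟩
      change ⟪_, _⟫_ℝ = 0
      rw [lp.inner_single_left]
      simp [lp.single_apply, hij]
    exact not_finite_iff_infinite.2 inferInstance hli.finite
  obtain ⟨v, hv⟩ := exists_isGenericSystem (chordSet_countable hSc) (chordSet_dense hS) hfin
  refine ⟨structureOfFamily S v, v, ?_, hv⟩
  let _ := structureOfFamily S v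
  refine ⟨hv.norm_eq, hv.linearIndependent, fun x y hxy => ?_, fun s x y => Iff.rfl⟩
  rw [norm_sub_eq_sqrt_of_norm_eq_one (hv.norm_eq x) (hv.norm_eq y)]
  exact (hv.inner_mem x y hxy).2

theorem IsGenericSystem.comp_equiv {N : Type*} {T : Set ℝ} {v : M → H}
    (hv : IsGenericSystem T v) (e : N ≃ M) : IsGenericSystem T (v ∘ e) where
  dense := hv.dense
  norm_eq x := hv.norm_eq _
  linearIndependent := hv.linearIndependent.comp e e.injective
  inner_mem x y hxy := hv.inner_mem _ _ fun h => hxy (e.injective h)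
  exists_inner_eq A ξ hξ hA := by
    obtain ⟨x, hx, h⟩ := hv.exists_inner_eq (A.map e.toEmbedding) ξ hξ (by
      intro a ha
      obtain ⟨b, hb, rfl⟩ := Finset.mem_map.1 ha
      exact hA b hb)
    refine ⟨e.symm x, fun h' => hx (Finset.mem_map.2 ⟨_, h', by simp⟩), fun a ha => ?_⟩
    simpa using h (e a) (Finset.mem_map_of_mem _ ha)

theorem exists_isHomogeneousSystem (hS : Dense S) (hSc : S.Countable) [Countable M]
    (hM : IsFraisseLimit (sphericalClass S) M) :
    ∃ v : M → lp (fun _ : ℕ => ℝ) 2,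
      IsHomogeneousSystem (chordSet S) v (autGroup (distLanguage S) M) := by
  obtain ⟨_, v, hv, hg⟩ := exists_isFraisseLimit hS hSc
  obtain ⟨e⟩ := hM.nonempty_equiv (hg.isFraisseLimit hv)
  exact ⟨v ∘ e.toEquiv, (hg.comp_equiv e.toEquiv).isHomogeneousSystem
    (hv.comp_embedding e.toEmbedding)⟩

end Limits

end DeFinettiGroups

/-! ### Transitivity, no algebraicity, infinitely many orbits. -/

namespace DeFinettiGroups

open scoped InnerProductSpace

namespace IsHomogeneousSystem

variable {M : Type} {H : Type*} [NormedAddCommGroup H] [InnerProductSpace ℝ H] {T : Set ℝ}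
  {v : M → H} {G : Subgroup (Equiv.Perm M)}

theorem inner_smul_smul (hv : IsHomogeneousSystem T v G) (g : G) (x y : M) :
    ⟪v (g • x), v (g • y)⟫_ℝ = ⟪v x, v y⟫_ℝ :=
  (hv.mem_iff g).1 g.2 x y

/-- A point outside of a finite set can be moved over this set to every point with the same
inner products. -/
theorem exists_mem_fixingSubgroup (hv : IsHomogeneousSystem T v G) {A : Finset M} {x y : M}
    (hx : x ∉ A) (hxy : ∀ a ∈ A, ⟪v y, v a⟫_ℝ = ⟪v x, v a⟫_ℝ) :
    ∃ g ∈ fixingSubgroup G (A : Set M), g • x = y := by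
  classical
  have hup : ∀ a ∈ A, Function.update id x y a = a := fun a ha =>
    Function.update_of_ne (by rintro rfl; exact hx ha) _ _
  have hupx : Function.update id x y x = y := Function.update_self _ _ _
  obtain ⟨g, hgG, hg⟩ := hv.exists_perm (insert x A) (Function.update id x y) (by
    intro a ha b hb
    rcases Finset.mem_insert.1 ha with rfl | ha' <;> rcases Finset.mem_insert.1 hb with rfl | hb'
    · rw [hupx, real_inner_self_eq_norm_sq, real_inner_self_eq_norm_sq, hv.norm_eq, hv.norm_eq]
    · rw [hupx, hup b hb', hxy b hb']
    · rw [hupx, hup a ha', real_inner_comm, hxy a ha', real_inner_comm]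
    · rw [hup a ha', hup b hb'])
  refine ⟨⟨g, hgG⟩, mem_fixingSubgroup_iff G |>.2 fun a ha => ?_, ?_⟩
  · exact (hg a (Finset.mem_insert_of_mem ha)).trans (hup a ha)
  · exact (hg x (Finset.mem_insert_self _ _)).trans hupx

theorem infinite (hv : IsHomogeneousSystem T v G) : Infinite M := by
  rw [← Set.infinite_univ_iff]
  intro h
  obtain ⟨x, hx, -⟩ := hv.exists_inner_near h.toFinset (ξ := 0) (by simp) one_pos
  simp at hx

theorem isPretransitive (hv : IsHomogeneousSystem T v G) : MulAction.IsPretransitive G M where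
  exists_smul_eq x y := by
    obtain ⟨g, -, hg⟩ := hv.exists_mem_fixingSubgroup (A := ∅) (x := x) (y := y) (by simp)
      (by simp)
    exact ⟨g, hg⟩

theorem notMem_span (hv : IsHomogeneousSystem T v G) {A : Finset M} {x : M} (hx : x ∉ A) :
    v x ∉ Submodule.span ℝ (v '' (A : Set M)) :=
  hv.linearIndependent.notMem_span_image (by simpa using hx)

/-- The projection of `v x` to the span of the tuple has norm less than `1`, so points with the same
inner products exist outside any finite set; homogeneity puts them in the orbit. -/
theorem noAlgebraicity (hv : IsHomogeneousSystem T v G) : NoAlgebraicity G := by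
  classical
  intro k a x hx hfin
  let A : Finset M := Finset.univ.image a
  have hA : (A : Set M) = Set.range a := by simp [A]
  have hxA : x ∉ A := by rwa [← Finset.mem_coe, hA]
  obtain ⟨c, hc, -, hlt⟩ := exists_sum_smul_inner_eq v A (v x)
  have hlt' := hlt (hv.notMem_span hxA)
  rw [hv.norm_eq] at hlt'
  obtain ⟨y, hy, hyA⟩ := hv.exists_inner_near (A ∪ hfin.toFinset) hlt' one_pos
  rw [Finset.mem_union, not_or] at hy
  obtain ⟨g, hg, rfl⟩ := hv.exists_mem_fixingSubgroup hxA (y := y) fun b hb => by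
    rw [← hc b hb]
    refine (hyA b (Finset.mem_union_left _ hb)).2 ?_
    rw [hc b hb]
    exact hv.inner_mem x b (by rintro rfl; exact hxA hb)
  refine hy.2 (hfin.mem_toFinset.2 ⟨⟨g, ?_⟩, rfl⟩)
  rwa [← hA]

theorem exists_inner_eq_of_mem (hv : IsHomogeneousSystem T v G) {t : ℝ} (ht : t ∈ T)
    (ht1 : |t| < 1) (x : M) : ∃ y, ⟪v y, v x⟫_ℝ = t := by
  have h1 : ⟪t • v x, v x⟫_ℝ = t := by
    rw [real_inner_smul_left, real_inner_self_eq_norm_sq, hv.norm_eq]; ring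
  obtain ⟨y, -, hy⟩ := hv.exists_inner_eq {x} (t • v x)
    (by rwa [norm_smul, hv.norm_eq, mul_one]) (by simpa [h1] using ht)
  exact ⟨y, by rw [hy x (by simp), h1]⟩

theorem not_alephZeroCategorical (hv : IsHomogeneousSystem T v G) :
    ¬ AlephZeroCategorical G := by
  intro h
  have := h 2
  have := hv.infinite
  obtain ⟨x⟩ : Nonempty M := inferInstance
  have hinv : ∀ p q : Fin 2 → M, MulAction.orbitRel G (Fin 2 → M) p q →
      ⟪v (p 0), v (p 1)⟫_ℝ = ⟪v (q 0), v (q 1)⟫_ℝ := by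
    rintro p q ⟨g, rfl⟩
    exact hv.inner_smul_smul g _ _
  let F : MulAction.orbitRel.Quotient G (Fin 2 → M) → ℝ :=
    Quotient.lift (fun p : Fin 2 → M => ⟪v (p 0), v (p 1)⟫_ℝ) hinv
  have hfin : (Set.range F).Finite := Set.finite_range F
  have hsub : T ∩ Set.Ioo (-1) 1 ⊆ Set.range F := by
    rintro t ⟨ht, ht1⟩
    obtain ⟨y, hy⟩ := hv.exists_inner_eq_of_mem ht (abs_lt.2 ht1) x
    exact ⟨Quotient.mk _ ![y, x], hy⟩
  -- If only finitely many values occurred, removing them from `(-1, 1)` would leave a nonempty open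
  -- set without points of `T`.
  obtain ⟨r, hr, hrF⟩ := (Set.Ioo_infinite (show (-1 : ℝ) < 1 by norm_num)).exists_notMem_finite
    (hfin.subset hsub)
  have hr' : r ∈ Set.Ioo (-1 : ℝ) 1 \ (T ∩ Set.Ioo (-1) 1) := ⟨hr, hrF⟩
  have hopen : IsOpen (Set.Ioo (-1 : ℝ) 1 \ (T ∩ Set.Ioo (-1) 1)) :=
    isOpen_Ioo.sdiff (hfin.subset hsub).isClosed
  obtain ⟨ε, hε, hball⟩ := Metric.isOpen_iff.1 hopen r hr'
  obtain ⟨t, ht, htr⟩ := hv.dense r (abs_lt.2 hr) ε hε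
  have := hball (show t ∈ Metric.ball r ε from htr)
  exact this.2 ⟨ht, this.1⟩

end IsHomogeneousSystem

/-! ### Weak elimination of imaginaries. -/

/-- A vector with prescribed equal inner products with two unit vectors `x` and `x'` which have the
same projection `p` to a subspace, and with prescribed projection `q` to the same subspace. -/
theorem exists_equal_inner {E : Type*} [NormedAddCommGroup E] [InnerProductSpace ℝ E]
    {p q x x' : E} (hx : ‖x‖ = 1) (hx' : ‖x'‖ = 1) (hxp : ⟪x, p⟫_ℝ = ⟪p, p⟫_ℝ)
    (hxp' : ⟪x', p⟫_ℝ = ⟪p, p⟫_ℝ) (hxq : ⟪x, q⟫_ℝ = ⟪p, q⟫_ℝ) (hxq' : ⟪x', q⟫_ℝ = ⟪p, q⟫_ℝ)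
    (hq : ‖q‖ < 1) {t : ℝ}
    (ht : 2 * t ^ 2 < (1 - ‖q‖ ^ 2) * (1 + ⟪x, x'⟫_ℝ - 2 * ‖p‖ ^ 2)) :
    ∃ ξ : E, ‖ξ‖ < 1 ∧ ⟪ξ, x⟫_ℝ = t + ⟪p, q⟫_ℝ ∧ ⟪ξ, x'⟫_ℝ = t + ⟪p, q⟫_ℝ ∧
      ∀ c, ⟪x, c⟫_ℝ = ⟪p, c⟫_ℝ → ⟪x', c⟫_ℝ = ⟪p, c⟫_ℝ → ⟪ξ, c⟫_ℝ = ⟪q, c⟫_ℝ := by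
  set d := 1 + ⟪x, x'⟫_ℝ - 2 * ‖p‖ ^ 2 with hd
  have hq1 : 0 < 1 - ‖q‖ ^ 2 := by nlinarith [norm_nonneg q]
  have hd0 : 0 < d := by
    by_contra h
    nlinarith [sq_nonneg t, mul_nonneg hq1.le (neg_nonneg.2 (not_lt.1 h))]
  rw [real_inner_self_eq_norm_sq] at hxp hxp'
  have hxx : ⟪x, x⟫_ℝ = 1 := by rw [real_inner_self_eq_norm_sq, hx, one_pow]
  have hxx' : ⟪x', x'⟫_ℝ = 1 := by rw [real_inner_self_eq_norm_sq, hx', one_pow]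
  have hxc : ⟪x', x⟫_ℝ = ⟪x, x'⟫_ℝ := real_inner_comm _ _
  have hpp : ⟪p, p⟫_ℝ = ‖p‖ ^ 2 := real_inner_self_eq_norm_sq p
  have hpx : ⟪p, x⟫_ℝ = ‖p‖ ^ 2 := by rw [real_inner_comm, hxp]
  have hpx' : ⟪p, x'⟫_ℝ = ‖p‖ ^ 2 := by rw [real_inner_comm, hxp']
  have hqx : ⟪q, x⟫_ℝ = ⟪p, q⟫_ℝ := by rw [real_inner_comm, hxq]
  have hqx' : ⟪q, x'⟫_ℝ = ⟪p, q⟫_ℝ := by rw [real_inner_comm, hxq']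
  have hqp : ⟪q, p⟫_ℝ = ⟪p, q⟫_ℝ := real_inner_comm _ _
  -- The correction is a multiple of `(x - p) + (x' - p)`, which is orthogonal to `q` and has
  -- squared norm `2 * d`; hence `‖ξ‖ ^ 2 = ‖q‖ ^ 2 + 2 * t ^ 2 / d`.
  refine ⟨q + (t / d) • (x + x' - (2 : ℝ) • p), ?_, ?_, ?_, fun c hc hc' => ?_⟩
  · have h1 : ‖q + (t / d) • (x + x' - (2 : ℝ) • p)‖ ^ 2 = ‖q‖ ^ 2 + 2 * t ^ 2 / d := by
      rw [norm_add_sq_real, norm_smul, mul_pow, ← real_inner_self_eq_norm_sq (x + x' - _)]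
      simp only [inner_add_left, inner_add_right, inner_sub_left, inner_sub_right,
        real_inner_smul_left, real_inner_smul_right, hxx, hxx', hxc, hpp, hpx, hpx', hxp, hxp',
        hqx, hqx', hqp, Real.norm_eq_abs, sq_abs]
      have : ⟪x, x'⟫_ℝ = d - 1 + 2 * ‖p‖ ^ 2 := by rw [hd]; ring
      rw [this]
      field_simp
      ring
    have h2 : 2 * t ^ 2 / d < 1 - ‖q‖ ^ 2 := by rwa [div_lt_iff₀ hd0]
    exact (sq_lt_one_iff₀ (norm_nonneg _)).1 (by linarith)
  · simp only [inner_add_left, inner_sub_left, real_inner_smul_left, hxx, hxc, hpx, hqx]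
    have : ⟪x, x'⟫_ℝ = d - 1 + 2 * ‖p‖ ^ 2 := by rw [hd]; ring
    rw [this]
    field_simp
    ring
  · simp only [inner_add_left, inner_sub_left, real_inner_smul_left, hxx', hpx', hqx']
    have : ⟪x, x'⟫_ℝ = d - 1 + 2 * ‖p‖ ^ 2 := by rw [hd]; ring
    rw [this]
    field_simp
    ring
  · simp only [inner_add_left, inner_sub_left, real_inner_smul_left, hc, hc']
    ring

namespace IsHomogeneousSystem

variable {M : Type} {H : Type*} [NormedAddCommGroup H] [InnerProductSpace ℝ H] {T : Set ℝ}
  {v : M → H} {G : Subgroup (Equiv.Perm M)}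

/-- Conjugating by `h ∈ V` carries the stabilizer of `C ∪ {a}` to that of `C ∪ {h • a}`, so the
latter also lies in `V`. -/
theorem mem_of_smul_fixed {V : Subgroup G} {C : Finset M} {a : M} [DecidableEq M]
    (ha : fixingSubgroup G ((insert a C : Finset M) : Set M) ≤ V) {h k : G} (hV : h ∈ V)
    (hC : h ∈ fixingSubgroup G (C : Set M)) (hkC : k ∈ fixingSubgroup G (C : Set M))
    (hk : k • h • a = h • a) : k ∈ V := by
  have h1 : h⁻¹ * k * h ∈ V := by
    refine ha ((mem_fixingSubgroup_iff G).2 fun y hy => ?_)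
    rw [mul_smul, mul_smul, inv_smul_eq_iff]
    rcases Finset.mem_insert.1 (Finset.mem_coe.1 hy) with rfl | hy
    · exact hk
    · rw [(mem_fixingSubgroup_iff G).1 hC y hy, (mem_fixingSubgroup_iff G).1 hkC y hy]
  have h2 := V.mul_mem (V.mul_mem hV h1) (V.inv_mem hV)
  simpa [mul_assoc] using h2

/-- If `x` is in the orbit of `a` under `V ∩ G_C`, then so is every `x'` which has a common
neighbour `y` with `x` in the graph of the pairs which are alike to `(a, b)` over `C`. -/
theorem exists_smul_eq_of_common_neighbour [DecidableEq M] (hv : IsHomogeneousSystem T v G)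
    {V : Subgroup G} {C : Finset M} {a b : M} (haC : a ∉ C) (hbC : b ∉ C) (hab : a ≠ b)
    (ha : fixingSubgroup G ((insert a C : Finset M) : Set M) ≤ V)
    (hb : fixingSubgroup G ((insert b C : Finset M) : Set M) ≤ V) {x x' y : M}
    (hx : ∃ h ∈ V, h ∈ fixingSubgroup G (C : Set M) ∧ h • a = x)
    (hx' : ∀ c ∈ C, ⟪v x', v c⟫_ℝ = ⟪v a, v c⟫_ℝ) (hy : ∀ c ∈ C, ⟪v y, v c⟫_ℝ = ⟪v b, v c⟫_ℝ)
    (hyx : ⟪v y, v x⟫_ℝ = ⟪v b, v a⟫_ℝ) (hyx' : ⟪v y, v x'⟫_ℝ = ⟪v b, v a⟫_ℝ) :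
    ∃ h ∈ V, h ∈ fixingSubgroup G (C : Set M) ∧ h • a = x' := by
  obtain ⟨h, hV, hC, rfl⟩ := hx
  have hfix : ∀ {g : G}, g ∈ fixingSubgroup G (C : Set M) → ∀ c ∈ C, g • c = c :=
    fun hg c hc => (mem_fixingSubgroup_iff G).1 hg c hc
  have hinner : ∀ {g : G}, g ∈ fixingSubgroup G (C : Set M) → ∀ z, ∀ c ∈ C,
      ⟪v (g • z), v c⟫_ℝ = ⟪v z, v c⟫_ℝ := fun {g} hg z c hc => by
    conv_lhs => rw [← hfix hg c hc]
    exact hv.inner_smul_smul g z c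
  have hnot : ∀ {g : G}, g ∈ fixingSubgroup G (C : Set M) → ∀ z ∉ C, g • z ∉ C := by
    intro g hg z hz hgz
    have h1 := hfix hg _ hgz
    exact hz ((smul_left_cancel g h1) ▸ hgz)
  obtain ⟨k, hk, hky⟩ := hv.exists_mem_fixingSubgroup (A := insert (h • a) C) (x := h • b) (y := y)
    (by
      rw [Finset.mem_insert, not_or]
      exact ⟨fun h' => hab (smul_left_cancel h h').symm, hnot hC b hbC⟩)
    (by
      intro c hc
      rcases Finset.mem_insert.1 hc with rfl | hc
      · rw [hyx, hv.inner_smul_smul]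
      · rw [hy c hc, hinner hC b c hc])
  rw [mem_fixingSubgroup_iff] at hk
  have hkC : k ∈ fixingSubgroup G (C : Set M) :=
    (mem_fixingSubgroup_iff G).2 fun c hc => hk c (by simp [Finset.mem_coe.1 hc])
  have hka : k • h • a = h • a := hk _ (by simp)
  have hkV : k ∈ V := mem_of_smul_fixed ha hV hC hkC hka
  have hkhV := V.mul_mem hkV hV
  have hkhC := (fixingSubgroup G (C : Set M)).mul_mem hkC hC
  obtain ⟨m, hm, hmx⟩ := hv.exists_mem_fixingSubgroup (A := insert y C) (x := h • a) (y := x')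
    (by
      rw [Finset.mem_insert, not_or]
      refine ⟨fun h' => hab ?_, hnot hC a haC⟩
      rw [← hka, ← hky] at h'
      exact smul_left_cancel h (smul_left_cancel k h'))
    (by
      intro c hc
      rcases Finset.mem_insert.1 hc with rfl | hc
      · rw [real_inner_comm, hyx', ← hyx, real_inner_comm]
      · rw [hx' c hc, hinner hC a c hc])
  rw [mem_fixingSubgroup_iff] at hm
  have hmC : m ∈ fixingSubgroup G (C : Set M) :=
    (mem_fixingSubgroup_iff G).2 fun c hc => hm c (by simp [Finset.mem_coe.1 hc])
  have hmV : m ∈ V := by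
    refine mem_of_smul_fixed hb hkhV hkhC hmC ?_
    rw [mul_smul, hky]
    exact hm y (by simp)
  exact ⟨m * (k * h), V.mul_mem hmV hkhV, mul_mem hmC hkhC, by
    rw [mul_smul, mul_smul, hka, hmx]⟩

/-- The pointwise stabilizer of `C` is generated by those of `C ∪ {a}` and `C ∪ {b}`. -/
theorem fixingSubgroup_le_of_insert [DecidableEq M] (hv : IsHomogeneousSystem T v G)
    {V : Subgroup G} {C : Finset M} {a b : M} (haC : a ∉ C) (hbC : b ∉ C) (hab : a ≠ b)
    (ha : fixingSubgroup G ((insert a C : Finset M) : Set M) ≤ V)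
    (hb : fixingSubgroup G ((insert b C : Finset M) : Set M) ≤ V) :
    fixingSubgroup G (C : Set M) ≤ V := by
  obtain ⟨ca, hp, -, hplt⟩ := exists_sum_smul_inner_eq v C (v a)
  obtain ⟨cb, hq, -, hqlt⟩ := exists_sum_smul_inner_eq v C (v b)
  have hp1 := hplt (hv.notMem_span haC)
  have hq1 := hqlt (hv.notMem_span hbC)
  rw [hv.norm_eq] at hp1 hq1
  set p := ∑ i ∈ C, ca i • v i with hpdef
  set q := ∑ i ∈ C, cb i • v i with hqdef
  have hsum : ∀ (x : M), (∀ c ∈ C, ⟪v x, v c⟫_ℝ = ⟪v a, v c⟫_ℝ) → ∀ d : M → ℝ,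
      ⟪v x, ∑ i ∈ C, d i • v i⟫_ℝ = ⟪p, ∑ i ∈ C, d i • v i⟫_ℝ := by
    intro x hx d
    rw [inner_sum, inner_sum]
    refine Finset.sum_congr rfl fun c hc => ?_
    rw [inner_smul_right, inner_smul_right, hx c hc, hp c hc]
  set P := ‖p‖ ^ 2 with hP
  have hP1 : 0 < 1 - P := by rw [hP]; nlinarith [norm_nonneg p]
  set Q := ‖q‖ ^ 2 with hQ
  have hQ1 : 0 < 1 - Q := by rw [hQ]; nlinarith [norm_nonneg q]
  set τ := ⟪v b, v a⟫_ℝ - ⟪p, q⟫_ℝ with hτ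
  -- Strict Cauchy–Schwarz for the components of `v a` and `v b` orthogonal to the span of `C`,
  -- which are linearly independent.
  have hτlt : τ ^ 2 < (1 - P) * (1 - Q) := by
    have hne : (v b - q) - (τ / (1 - P)) • (v a - p) ≠ 0 := by
      intro h0
      apply hv.notMem_span (A := insert a C) (x := b) (by simp [hab.symm, hbC])
      have hmemC : ∀ d : M → ℝ, ∑ i ∈ C, d i • v i ∈
          Submodule.span ℝ (v '' ((insert a C : Finset M) : Set M)) := fun d =>
        Submodule.sum_mem _ fun i hi => Submodule.smul_mem _ _
          (Submodule.subset_span ⟨i, by simp [hi], rfl⟩)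
      have hvb : v b = q + (τ / (1 - P)) • (v a - p) := by
        rw [← sub_eq_zero, ← h0]; abel
      rw [hvb]
      exact Submodule.add_mem _ (hmemC cb) (Submodule.smul_mem _ _ (Submodule.sub_mem _
        (Submodule.subset_span ⟨a, by simp, rfl⟩) (hmemC ca)))
    have hpos : 0 < ‖(v b - q) - (τ / (1 - P)) • (v a - p)‖ ^ 2 := by positivity
    have e1 : ⟪v a, p⟫_ℝ = P := by
      rw [hP, ← real_inner_self_eq_norm_sq]; exact hsum a (fun _ _ => rfl) ca
    have e2 : ⟪v a, q⟫_ℝ = ⟪p, q⟫_ℝ := hsum a (fun _ _ => rfl) cb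
    have e3 : ∀ d : M → ℝ, ⟪v b, ∑ i ∈ C, d i • v i⟫_ℝ = ⟪q, ∑ i ∈ C, d i • v i⟫_ℝ := by
      intro d
      rw [inner_sum, inner_sum]
      refine Finset.sum_congr rfl fun c hc => ?_
      rw [inner_smul_right, inner_smul_right, hq c hc]
    have e4 : ⟪v b, p⟫_ℝ = ⟪p, q⟫_ℝ := (e3 ca).trans (real_inner_comm _ _)
    have e5 : ⟪v b, q⟫_ℝ = Q := by
      rw [hQ, ← real_inner_self_eq_norm_sq]; exact e3 cb
    have n1 : ‖v b - q‖ ^ 2 = 1 - Q := by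
      rw [norm_sub_sq_real, hv.norm_eq, e5, ← hQ]; ring
    have n2 : ‖v a - p‖ ^ 2 = 1 - P := by
      rw [norm_sub_sq_real, hv.norm_eq, e1, ← hP]; ring
    have n3 : ⟪v b - q, v a - p⟫_ℝ = τ := by
      rw [inner_sub_left, inner_sub_right, inner_sub_right, e4, real_inner_comm (v a) q, e2,
        real_inner_comm p q, hτ]; ring
    rw [norm_sub_sq_real, inner_smul_right, norm_smul, mul_pow, n1, n2, n3, Real.norm_eq_abs,
      sq_abs] at hpos
    have h2 : 1 - Q - 2 * (τ / (1 - P) * τ) + (τ / (1 - P)) ^ 2 * (1 - P)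
        = ((1 - P) * (1 - Q) - τ ^ 2) / (1 - P) := by
      field_simp
      ring
    rw [h2, div_pos_iff_of_pos_right hP1] at hpos
    linarith
  let R : M → Prop := fun x => ∃ h ∈ V, h ∈ fixingSubgroup G (C : Set M) ∧ h • a = x
  have hR : ∀ x, R x → ∀ c ∈ C, ⟪v x, v c⟫_ℝ = ⟪v a, v c⟫_ℝ := by
    rintro x ⟨h, -, hC, rfl⟩ c hc
    conv_lhs => rw [← (mem_fixingSubgroup_iff G).1 hC c hc]
    exact hv.inner_smul_smul h a c
  -- Here `⟪v x, v x'⟫ - P` is the inner product of the components orthogonal to `C`. The aim is to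
  -- lower `r` below `0`.
  let near : ℝ → Prop := fun r => ∀ x x', R x → (∀ c ∈ C, ⟪v x', v c⟫_ℝ = ⟪v a, v c⟫_ℝ) →
    r < ⟪v x, v x'⟫_ℝ - P → R x'
  have hpair : ∀ x x', R x → (∀ c ∈ C, ⟪v x', v c⟫_ℝ = ⟪v a, v c⟫_ℝ) → ∀ d : M → ℝ, ∀ t : ℝ,
      ‖∑ i ∈ C, d i • v i‖ < 1 →
      2 * t ^ 2 < (1 - ‖∑ i ∈ C, d i • v i‖ ^ 2) * (1 + ⟪v x, v x'⟫_ℝ - 2 * P) →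
      ∃ ξ : H, ‖ξ‖ < 1 ∧ ⟪ξ, v x⟫_ℝ = t + ⟪p, ∑ i ∈ C, d i • v i⟫_ℝ ∧
        ⟪ξ, v x'⟫_ℝ = t + ⟪p, ∑ i ∈ C, d i • v i⟫_ℝ ∧
        ∀ c ∈ C, ⟪ξ, v c⟫_ℝ = ⟪∑ i ∈ C, d i • v i, v c⟫_ℝ := by
    intro x x' hx hx' d t hd ht
    obtain ⟨ξ, h1, h2, h3, h4⟩ := exists_equal_inner (hv.norm_eq x) (hv.norm_eq x')
      (hsum x (hR x hx) ca) (hsum x' hx' ca) (hsum x (hR x hx) d) (hsum x' hx' d) hd ht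
    exact ⟨ξ, h1, h2, h3, fun c hc => h4 _ (by rw [hR x hx c hc, hp c hc])
      (by rw [hx' c hc, hp c hc])⟩
  have hTa : ∀ c ∈ C, ⟪v a, v c⟫_ℝ ∈ T := fun c hc =>
    hv.inner_mem a c (by rintro rfl; exact haC hc)
  have hTb : ∀ c ∈ C, ⟪v b, v c⟫_ℝ ∈ T := fun c hc =>
    hv.inner_mem b c (by rintro rfl; exact hbC hc)
  -- Exactly the margin under which `exists_equal_inner` supplies a common neighbour of `x` and
  -- `x'`.
  set δ₀ := 2 * (1 - P) - 2 * τ ^ 2 / (1 - Q) with hδ₀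
  have hδ₀pos : 0 < δ₀ := by
    have : τ ^ 2 / (1 - Q) < 1 - P := by rwa [div_lt_iff₀ hQ1]
    rw [hδ₀, mul_div_assoc]; linarith
  have hbase : near (1 - P - δ₀) := by
    intro x x' hx hx' hlt
    obtain ⟨ξ, hξ, hξx, hξx', hξC⟩ := hpair x x' hx hx' cb τ hq1 (by
      have h1 : 2 * τ ^ 2 / (1 - Q) < 1 + ⟪v x, v x'⟫_ℝ - 2 * P := by
        rw [hδ₀] at hlt; linarith
      rw [div_lt_iff₀ hQ1] at h1
      linarith)
    have hτ' : τ + ⟪p, q⟫_ℝ = ⟪v b, v a⟫_ℝ := by rw [hτ]; ring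
    have hTab : ⟪v b, v a⟫_ℝ ∈ T := hv.inner_mem b a hab.symm
    rw [hτ'] at hξx hξx'
    obtain ⟨y, -, hy⟩ := hv.exists_inner_eq (insert x (insert x' C)) ξ hξ (by
      intro c hc
      rcases Finset.mem_insert.1 hc with rfl | hc
      · rwa [hξx]
      rcases Finset.mem_insert.1 hc with rfl | hc
      · rwa [hξx']
      · rw [hξC c hc, hq c hc]; exact hTb c hc)
    refine hv.exists_smul_eq_of_common_neighbour haC hbC hab ha hb hx hx' (y := y)
      (fun c hc => ?_) ?_ ?_
    · rw [hy c (by simp [hc]), hξC c hc, hq c hc]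
    · rw [hy x (by simp), hξx]
    · rw [hy x' (by simp), hξx']
  -- Passage through an intermediate point `z`. The value `t` need not be in `T`, so it is only
  -- approximated, and `r < t` absorbs the error.
  have hmid : ∀ x x' r t, R x → (∀ c ∈ C, ⟪v x', v c⟫_ℝ = ⟪v a, v c⟫_ℝ) → near r → r < t →
      (∃ ξ : H, ‖ξ‖ < 1 ∧ ⟪ξ, v x⟫_ℝ = t + P ∧ ⟪ξ, v x'⟫_ℝ = t + P ∧
        ∀ c ∈ C, ⟪ξ, v c⟫_ℝ = ⟪p, v c⟫_ℝ) → R x' := by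
    rintro x x' r t hx hx' hr hrt ⟨ξ, hξ, hξx, hξx', hξC⟩
    obtain ⟨z, -, hz⟩ := hv.exists_inner_near (insert x (insert x' C)) hξ (sub_pos.2 hrt)
    have hzC : ∀ c ∈ C, ⟪v z, v c⟫_ℝ = ⟪v a, v c⟫_ℝ := fun c hc => by
      rw [← hp c hc, ← hξC c hc]
      refine (hz c (by simp [hc])).2 ?_
      rw [hξC c hc, hp c hc]
      exact hTa c hc
    have h1 := (abs_lt.1 (hz x (by simp)).1).1
    have h2 := (abs_lt.1 (hz x' (by simp)).1).1
    rw [hξx] at h1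
    rw [hξx'] at h2
    have hRz : R z := hr x z hx hzC (by rw [real_inner_comm]; linarith)
    exact hr z x' hRz hx' (by linarith)
  -- The intermediate point has orthogonal inner product about `1 - P - 7 / 8 * δ` with both ends:
  -- `7 / 8 < 1` leaves room for approximation, and `δ ≤ 1 - P` gives the norm bound.
  have hstep : ∀ δ, 0 < δ → δ ≤ 1 - P → near (1 - P - δ) → near (1 - P - 3 / 2 * δ) := by
    intro δ hδ hδP hnear x x' hx hx' hlt
    refine hmid x x' _ (1 - P - 7 / 8 * δ) hx hx' hnear (by linarith) ?_
    obtain ⟨ξ, h1, h2, h3, h4⟩ := hpair x x' hx hx' ca (1 - P - 7 / 8 * δ) hp1 (by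
      change _ < (1 - P) * _
      nlinarith)
    have hpp : ⟪p, p⟫_ℝ = P := real_inner_self_eq_norm_sq p
    change ⟪ξ, v x⟫_ℝ = _ + ⟪p, p⟫_ℝ at h2
    change ⟪ξ, v x'⟫_ℝ = _ + ⟪p, p⟫_ℝ at h3
    rw [hpp] at h2 h3
    exact ⟨ξ, h1, h2, h3, h4⟩
  obtain ⟨r, hr0, hr⟩ : ∃ r < 0, near r := by
    by_contra! hcon
    have hall : ∀ n : ℕ, near (1 - P - (3 / 2) ^ n * δ₀) := by
      intro n
      induction n with
      | zero => simpa using hbase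
      | succ n ih =>
        have hle : (3 / 2) ^ n * δ₀ ≤ 1 - P := by
          by_contra! h
          exact hcon _ (by linarith) ih
        have := hstep _ (by positivity) hle ih
        rwa [pow_succ, mul_comm _ (3 / 2 : ℝ), mul_assoc]
    obtain ⟨n, hn⟩ := pow_unbounded_of_one_lt ((1 - P) / δ₀) (show (1 : ℝ) < 3 / 2 by norm_num)
    rw [div_lt_iff₀ hδ₀pos] at hn
    exact hcon _ (by linarith) (hall n)
  -- Once `r < 0`, a point almost orthogonal, modulo `C`, to both `a` and `x'` links them.
  have hall : ∀ x', (∀ c ∈ C, ⟪v x', v c⟫_ℝ = ⟪v a, v c⟫_ℝ) → R x' := by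
    intro x' hx'
    have hRa : R a := ⟨1, V.one_mem, one_mem _, one_smul _ _⟩
    have hpp : ⟪p, p⟫_ℝ = P := real_inner_self_eq_norm_sq p
    refine hmid a x' r 0 hRa hx' hr hr0 ⟨p, hp1, ?_, ?_, fun _ _ => rfl⟩
    · rw [real_inner_comm, hsum a (fun _ _ => rfl) ca, zero_add, ← hpp]
    · rw [real_inner_comm, hsum x' hx' ca, zero_add, ← hpp]
  intro g hg
  obtain ⟨h, hV, hC, hha⟩ := hall (g • a) fun c hc => by
    conv_lhs => rw [← (mem_fixingSubgroup_iff G).1 hg c hc]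
    exact hv.inner_smul_smul g a c
  have h1 : h⁻¹ * g ∈ V := by
    refine ha ((mem_fixingSubgroup_iff G).2 fun y hy => ?_)
    rw [mul_smul, inv_smul_eq_iff]
    rcases Finset.mem_insert.1 (Finset.mem_coe.1 hy) with rfl | hy
    · exact hha.symm
    · rw [(mem_fixingSubgroup_iff G).1 hC y hy, (mem_fixingSubgroup_iff G).1 hg y hy]
  simpa using V.mul_mem hV h1

/-- Downward induction from `A ∪ B`: a set `X` containing neither `A` nor `B` is enlarged by a point
of each, and `fixingSubgroup_le_of_insert` removes them again. -/
theorem fixingSubgroup_inter_le [DecidableEq M] (hv : IsHomogeneousSystem T v G)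
    {V : Subgroup G} {A B : Finset M} (hA : fixingSubgroup G (A : Set M) ≤ V)
    (hB : fixingSubgroup G (B : Set M) ≤ V) : fixingSubgroup G ((A ∩ B : Finset M) : Set M) ≤ V := by
  have key : ∀ (n : ℕ) (X : Finset M), A ∩ B ⊆ X → ((A ∪ B) \ X).card = n →
      fixingSubgroup G (X : Set M) ≤ V := by
    intro n
    induction n using Nat.strong_induction_on with
    | _ n ih =>
      intro X hX hn
      by_cases hAX : A ⊆ X
      · exact (fixingSubgroup_antitone G M (by exact_mod_cast hAX)).trans hA
      by_cases hBX : B ⊆ X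
      · exact (fixingSubgroup_antitone G M (by exact_mod_cast hBX)).trans hB
      obtain ⟨a, haA, haX⟩ := Finset.not_subset.1 hAX
      obtain ⟨b, hbB, hbX⟩ := Finset.not_subset.1 hBX
      have hins : ∀ c ∈ A ∪ B, c ∉ X →
          fixingSubgroup G ((insert c X : Finset M) : Set M) ≤ V := by
        intro c hc hcX
        refine ih _ ?_ _ (hX.trans (Finset.subset_insert _ _)) rfl
        rw [← hn]
        refine Finset.card_lt_card ⟨Finset.sdiff_subset_sdiff subset_rfl
          (Finset.subset_insert _ _), fun h => ?_⟩
        have := h (Finset.mem_sdiff.2 ⟨hc, hcX⟩)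
        simp at this
      refine hv.fixingSubgroup_le_of_insert haX hbX ?_ (hins a (by simp [haA]) haX)
        (hins b (by simp [hbB]) hbX)
      rintro rfl
      exact haX (hX (Finset.mem_inter.2 ⟨haA, hbB⟩))
  exact key _ _ subset_rfl rfl

end IsHomogeneousSystem

theorem exists_fixingSubgroup_le_of_isOpen {M : Type} {G : Subgroup (Equiv.Perm M)}
    {V : Subgroup G} (hV : IsOpen[pointwiseTopology G] (V : Set G)) :
    ∃ A : Finset M, fixingSubgroup G (A : Set M) ≤ V := by
  obtain ⟨U, hU, hUV⟩ := hV
  have h1 : (fun x : M => (1 : G) • x) ∈ U := by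
    have : (1 : G) ∈ (fun g : G => fun x : M => g • x) ⁻¹' U := hUV ▸ V.one_mem
    exact this
  obtain ⟨A, u, hu, hAu⟩ := (@isOpen_pi_iff M (fun _ => M) (fun _ => ⊥) U).1 hU _ h1
  refine ⟨A, fun g hg => ?_⟩
  have : g ∈ (fun g : G => fun x : M => g • x) ⁻¹' U := by
    refine hAu fun a ha => ?_
    have h2 := (mem_fixingSubgroup_iff G).1 hg a ha
    simp only [h2]
    simpa using (hu a ha).2
  rwa [hUV] at this

theorem IsHomogeneousSystem.weakEliminationOfImaginaries {M : Type} {H : Type*}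
    [NormedAddCommGroup H] [InnerProductSpace ℝ H] {T : Set ℝ} {v : M → H}
    {G : Subgroup (Equiv.Perm M)} (hv : IsHomogeneousSystem T v G) :
    WeakEliminationOfImaginaries G := by
  classical
  intro V _ hV
  obtain ⟨A, hA, hmin⟩ : ∃ A : Finset M, fixingSubgroup G (A : Set M) ≤ V ∧
      ∀ B : Finset M, fixingSubgroup G (B : Set M) ≤ V → A.card ≤ B.card := by
    have hex : ∃ n, ∃ A : Finset M, fixingSubgroup G (A : Set M) ≤ V ∧ A.card = n := by
      obtain ⟨A, hA⟩ := exists_fixingSubgroup_le_of_isOpen hV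
      exact ⟨_, A, hA, rfl⟩
    obtain ⟨A, hA, hAn⟩ := Nat.find_spec hex
    exact ⟨A, hA, fun B hB => hAn ▸ Nat.find_min' hex ⟨B, hB, rfl⟩⟩
  -- For `g ∈ V` the stabilizer of `g • A` also lies in `V`, hence so does that of `A ∩ g • A`;
  -- minimality gives `g • A = A`.
  have hstab : ∀ g ∈ V, ∀ a ∈ A, g • a ∈ A := by
    intro g hg
    have h1 : fixingSubgroup G ((A.image (g • ·) : Finset M) : Set M) ≤ V := by
      intro k hk
      have h2 : g⁻¹ * k * g ∈ V := by
        refine hA ((mem_fixingSubgroup_iff G).2 fun a ha => ?_)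
        rw [mul_smul, mul_smul, inv_smul_eq_iff]
        exact (mem_fixingSubgroup_iff G).1 hk _
          (by exact_mod_cast Finset.mem_image_of_mem (g • ·) (Finset.mem_coe.1 ha))
      simpa [mul_assoc] using V.mul_mem (V.mul_mem hg h2) (V.inv_mem hg)
    have h2 := hmin _ (hv.fixingSubgroup_inter_le hA h1)
    have h3 : A ∩ A.image (g • ·) = A := Finset.eq_of_subset_of_card_le Finset.inter_subset_left h2
    have h4 : A.image (g • ·) = A :=
      (Finset.eq_of_subset_of_card_le (Finset.inter_eq_left.1 h3) Finset.card_image_le).symm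
    intro a ha
    rw [← h4]
    exact Finset.mem_image_of_mem (g • ·) ha
  refine ⟨A.card, fun i => (A.equivFin.symm i : M), ?_⟩
  have hrange : Set.range (fun i => (A.equivFin.symm i : M)) = (A : Set M) := by
    ext x
    constructor
    · rintro ⟨i, rfl⟩
      exact (A.equivFin.symm i).2
    · intro hx
      exact ⟨A.equivFin ⟨x, hx⟩, by simp⟩
  rw [hrange]
  refine ⟨hA, ?_⟩
  rw [Subgroup.isFiniteRelIndex_iff_finiteIndex]
  have hfin : ∀ a ∈ A, (MulAction.stabilizer V a).FiniteIndex := by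
    intro a ha
    refine ⟨?_⟩
    rw [MulAction.index_stabilizer]
    have hsub : MulAction.orbit V a ⊆ A := by
      rintro _ ⟨g, rfl⟩
      exact hstab g g.2 a ha
    exact (Set.ncard_pos (A.finite_toSet.subset hsub)).2 (MulAction.nonempty_orbit a) |>.ne'
  have := Subgroup.finiteIndex_iInf' (fun a : M => MulAction.stabilizer V a) hfin
  refine Subgroup.finiteIndex_of_le (H := ⨅ a ∈ A, MulAction.stabilizer V a) ?_
  intro g hg
  rw [Subgroup.mem_subgroupOf, mem_fixingSubgroup_iff]
  intro a ha
  simp only [Subgroup.mem_iInf] at hg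
  exact hg a ha

end DeFinettiGroups

/-! ### Characters and Gaussian laws on `ℝ ^ M`. -/

namespace DeFinettiGroups

open scoped InnerProductSpace

section CharacteristicFunctions

variable {M : Type*}

/-- The character of `ℝ ^ M` attached to a finitely supported family of coefficients. -/
noncomputable def character (c : M →₀ ℝ) (X : M → ℝ) : ℂ :=
  Complex.exp ((Finsupp.linearCombination ℝ X c : ℝ) * Complex.I)

@[fun_prop]
theorem measurable_character (c : M →₀ ℝ) : Measurable (character c) := by
  unfold character
  have : Measurable fun X : M → ℝ => Finsupp.linearCombination ℝ X c := by
    simp only [Finsupp.linearCombination_apply, Finsupp.sum]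
    fun_prop
  fun_prop

theorem norm_character (c : M →₀ ℝ) (X : M → ℝ) : ‖character c X‖ = 1 :=
  Complex.norm_exp_ofReal_mul_I _

theorem integrable_character (c : M →₀ ℝ) (μ : Measure (M → ℝ)) [IsFiniteMeasure μ] :
    Integrable (character c) μ :=
  Integrable.of_bound (measurable_character c).aestronglyMeasurable 1
    (ae_of_all _ fun X => (norm_character c X).le)

theorem character_mul_conj (c d : M →₀ ℝ) (X : M → ℝ) :
    character c X * (starRingEnd ℂ) (character d X) = character (c - d) X := by
  simp only [character, ← Complex.exp_conj, map_mul, Complex.conj_ofReal, Complex.conj_I,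
    ← Complex.exp_add, map_sub, Complex.ofReal_sub]
  ring_nf

theorem conj_character (d : M →₀ ℝ) (X : M → ℝ) :
    (starRingEnd ℂ) (character d X) = character (-d) X := by
  simp only [character, ← Complex.exp_conj, map_mul, Complex.conj_ofReal, Complex.conj_I,
    map_neg, Complex.ofReal_neg]
  ring_nf

theorem character_comp {N : Type*} (f : N → M) (c : N →₀ ℝ) (X : M → ℝ) :
    character c (fun a => X (f a)) = character (c.mapDomain f) X := by
  rw [character, character, Finsupp.linearCombination_mapDomain]
  rfl

/-- A finite measure on `ℝ ^ M` is determined by the integrals of the characters. -/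
theorem ext_of_integral_character {μ ν : Measure (M → ℝ)} [IsFiniteMeasure μ] [IsFiniteMeasure ν]
    (h : ∀ c : M →₀ ℝ, ∫ X, character c X ∂μ = ∫ X, character c X ∂ν) : μ = ν := by
  classical
  have key : ∀ I : Finset M, μ.map I.restrict = ν.map I.restrict := by
    intro I
    refine Measure.ext_of_charFunDual ?_
    ext L
    let c : M →₀ ℝ := ∑ i : I, Finsupp.single (i : M) (L (Pi.single i 1))
    have hc : ∀ X : M → ℝ, L (I.restrict X) = Finsupp.linearCombination ℝ X c := by
      intro X
      simp only [c, map_sum, Finsupp.linearCombination_single]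
      conv_lhs => rw [← Finset.univ_sum_single (I.restrict X)]
      rw [map_sum]
      refine Finset.sum_congr rfl fun i _ => ?_
      rw [smul_eq_mul, mul_comm, ← smul_eq_mul, ← map_smul, ← Pi.single_smul]
      simp
    rw [charFunDual_apply, charFunDual_apply, integral_map (by fun_prop) (by fun_prop),
      integral_map (by fun_prop) (by fun_prop)]
    simpa only [character, hc] using h c
  have hμ : IsProjectiveLimit μ (fun I : Finset M => μ.map I.restrict) := fun I => rfl
  have hν : IsProjectiveLimit ν (fun I : Finset M => μ.map I.restrict) := fun I => (key I).symm
  exact hμ.unique hν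

end CharacteristicFunctions

section GaussianProcess

variable {M : Type*} {H : Type*} [NormedAddCommGroup H] [InnerProductSpace ℝ H]

/-- The measure `μ` is the law of a centered Gaussian process with the covariance of `v`. -/
def IsGaussianLaw (v : M → H) (μ : Measure (M → ℝ)) : Prop :=
  ∀ c : M →₀ ℝ, ∫ X, character c X ∂μ =
    (Real.exp (-‖Finsupp.linearCombination ℝ v c‖ ^ 2 / 2) : ℝ)

theorem integral_character_infinitePi_gaussianReal (d : ℕ →₀ ℝ) :
    ∫ X, character d X ∂(Measure.infinitePi fun _ : ℕ => ProbabilityTheory.gaussianReal 0 1) =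
      (Real.exp (-(∑ i ∈ d.support, d i ^ 2) / 2) : ℝ) := by
  let F : (d.support → ℝ) → ℂ := fun y => ∏ i : d.support, Complex.exp (d (i : ℕ) * y i * Complex.I)
  have hF : ∀ X : ℕ → ℝ, character d X = F (d.support.restrict X) := by
    intro X
    simp only [character, F, Finsupp.linearCombination_apply, Finsupp.sum, Finset.restrict]
    rw [← Complex.exp_sum, Finset.sum_coe_sort d.support
      (fun i => (d i : ℂ) * (X i : ℂ) * Complex.I), ← Finset.sum_mul]
    push_cast
    simp
  simp_rw [hF]
  rw [integral_restrict_infinitePi (fun _ : ℕ => ProbabilityTheory.gaussianReal 0 1) (f := F)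
    (Measurable.aestronglyMeasurable (by fun_prop))]
  simp only [F]
  rw [integral_fintype_prod_eq_prod
    (f := fun (i : d.support) (x : ℝ) => Complex.exp (d i * x * Complex.I))]
  simp_rw [← charFun_apply_real, ProbabilityTheory.charFun_gaussianReal]
  rw [← Complex.exp_sum, Finset.sum_coe_sort d.support
    (fun i => (d i : ℂ) * (0 : ℝ) * Complex.I - (1 : NNReal) * (d i : ℂ) ^ 2 / 2)]
  push_cast
  congr 1
  rw [neg_div, Finset.sum_div, ← Finset.sum_neg_distrib]
  simp

/-- Each `v x` has finitely many coordinates in the Gram–Schmidt basis; the process takes the same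
combinations of independent standard Gaussians. -/
theorem exists_isGaussianLaw [Countable M] [Infinite M] {v : M → H}
    (hv : LinearIndependent ℝ v) :
    ∃ μ : Measure (M → ℝ), IsProbabilityMeasure μ ∧ IsGaussianLaw v μ := by
  obtain ⟨e⟩ := nonempty_equiv_of_countable (α := ℕ) (β := M)
  let b := InnerProductSpace.gramSchmidtNormed ℝ (v ∘ e)
  have hb : Orthonormal ℝ b :=
    InnerProductSpace.gramSchmidtNormed_orthonormal (hv.comp e e.injective)
  have hspan : ∀ x, ∃ a : ℕ →₀ ℝ, Finsupp.linearCombination ℝ b a = v x := by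
    intro x
    rw [← Set.mem_range, ← LinearMap.coe_range, SetLike.mem_coe, Finsupp.range_linearCombination,
      InnerProductSpace.span_gramSchmidtNormed_range, InnerProductSpace.span_gramSchmidt]
    exact Submodule.subset_span ⟨e.symm x, by simp⟩
  choose a ha using hspan
  let Φ : (ℕ → ℝ) → M → ℝ := fun ω x => Finsupp.linearCombination ℝ ω (a x)
  have hΦ : Measurable Φ := by
    refine measurable_pi_lambda _ fun x => ?_
    simp only [Φ, Finsupp.linearCombination_apply, Finsupp.sum]
    fun_prop
  have hch : ∀ (c : M →₀ ℝ) (ω : ℕ → ℝ),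
      character c (Φ ω) = character (Finsupp.linearCombination ℝ a c) ω := by
    intro c ω
    rw [character, character]
    congr 3
    simp only [Finsupp.linearCombination_apply, Finsupp.sum, map_sum, map_smul, Φ]
  let γ := Measure.infinitePi fun _ : ℕ => ProbabilityTheory.gaussianReal 0 1
  refine ⟨γ.map Φ, Measure.isProbabilityMeasure_map hΦ.aemeasurable, fun c => ?_⟩
  rw [integral_map hΦ.aemeasurable (measurable_character c).aestronglyMeasurable]
  simp_rw [hch]
  rw [integral_character_infinitePi_gaussianReal]
  set d := Finsupp.linearCombination ℝ a c with hd
  have h1 : Finsupp.linearCombination ℝ v c = Finsupp.linearCombination ℝ b d := by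
    rw [hd, Finsupp.linearCombination_apply ℝ (v := a), Finsupp.sum, map_sum,
      Finsupp.linearCombination_apply, Finsupp.sum]
    exact Finset.sum_congr rfl fun x _ => by rw [map_smul, ha]
  have h2 : ‖Finsupp.linearCombination ℝ b d‖ ^ 2 = ∑ i ∈ d.support, d i ^ 2 := by
    rw [← real_inner_self_eq_norm_sq, hb.inner_finsupp_eq_sum_left, Finsupp.sum]
    exact Finset.sum_congr rfl fun i _ => by simp [sq]
  rw [h1, h2]

/-- The covariance of two of the characters is `exp (-r ^ 2) * (exp ⟪ξ i, ξ j⟫ - 1)`: at most `1` on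
the diagonal and at most `ε` off it. -/
theorem IsGaussianLaw.integral_norm_sum_sq_le {v : M → H} {μ : Measure (M → ℝ)}
    [IsProbabilityMeasure μ] (hμ : IsGaussianLaw v μ) (c : ℕ → M →₀ ℝ) {r ε : ℝ} (N : ℕ)
    (hr : ∀ n, ‖Finsupp.linearCombination ℝ v (c n)‖ = r)
    (hε : ∀ i j, i ≠ j → |Real.exp ⟪Finsupp.linearCombination ℝ v (c i),
      Finsupp.linearCombination ℝ v (c j)⟫_ℝ - 1| ≤ ε) :
    ∫ X, ‖∑ n ∈ Finset.range N, (character (c n) X - (Real.exp (-r ^ 2 / 2) : ℝ))‖ ^ 2 ∂μ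
      ≤ N + N ^ 2 * ε := by
  classical
  set m : ℝ := Real.exp (-r ^ 2 / 2) with hm
  set ξ : ℕ → H := fun n => Finsupp.linearCombination ℝ v (c n) with hξ
  have hpair : ∀ i j, ∫ X, (character (c i) X - m) * (starRingEnd ℂ) (character (c j) X - m) ∂μ =
      ((Real.exp (-r ^ 2) * (Real.exp ⟪ξ i, ξ j⟫_ℝ - 1) : ℝ) : ℂ) := by
    intro i j
    have hexp : ∀ X, (character (c i) X - m) * (starRingEnd ℂ) (character (c j) X - m) =
        character (c i - c j) X - m * character (c i) X - m * character (-(c j)) X + m * m := by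
      intro X
      rw [← character_mul_conj, ← conj_character, map_sub, Complex.conj_ofReal]
      ring
    simp_rw [hexp]
    have i1 : ∀ d, Integrable (fun X => (m : ℂ) * character d X) μ := fun d =>
      (integrable_character d μ).const_mul _
    have i2 : Integrable (fun X => character (c i - c j) X - m * character (c i) X) μ :=
      (integrable_character _ μ).sub (i1 _)
    have i3 : Integrable (fun X => character (c i - c j) X - m * character (c i) X -
        m * character (-(c j)) X) μ := i2.sub (i1 _)
    rw [integral_add i3 (integrable_const _), integral_sub i2 (i1 _),
      integral_sub (integrable_character _ μ) (i1 _),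
      integral_const_mul, integral_const_mul, hμ, hμ, hμ, map_neg, norm_neg, map_sub, hr, hr]
    have h1 : ‖ξ i - ξ j‖ ^ 2 = 2 * r ^ 2 - 2 * ⟪ξ i, ξ j⟫_ℝ := by
      rw [norm_sub_sq_real, hr, hr]; ring
    change ((Real.exp (-‖ξ i - ξ j‖ ^ 2 / 2) : ℝ) : ℂ) - _ - _ + _ = _
    rw [h1]
    have h2 : Real.exp (-(2 * r ^ 2 - 2 * ⟪ξ i, ξ j⟫_ℝ) / 2) =
        Real.exp (-r ^ 2) * Real.exp ⟪ξ i, ξ j⟫_ℝ := by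
      rw [← Real.exp_add]; ring_nf
    have h3 : m * m = Real.exp (-r ^ 2) := by
      rw [hm, ← Real.exp_add]; ring_nf
    rw [h2, mul_sub, mul_one, ← h3]
    simp only [integral_const, probReal_univ, one_smul]
    rw [← hm]
    push_cast
    ring
  have hint : ∀ i j, Integrable (fun X =>
      (character (c i) X - m) * (starRingEnd ℂ) (character (c j) X - m)) μ := by
    intro i j
    refine Integrable.of_bound (C := (1 + |m|) * (1 + |m|))
      (Measurable.aestronglyMeasurable ?_) (ae_of_all _ fun X => ?_)
    · exact ((measurable_character _).sub_const _).mul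
        (Complex.continuous_conj.measurable.comp ((measurable_character _).sub_const _))
    · have hb : ∀ n, ‖character (c n) X - m‖ ≤ 1 + |m| := fun n => by
        refine (norm_sub_le _ _).trans ?_
        rw [norm_character, Complex.norm_real, Real.norm_eq_abs]
      rw [norm_mul, RCLike.norm_conj]
      exact mul_le_mul (hb i) (hb j) (norm_nonneg _) (by positivity)
  have hsum : ((∫ X, ‖∑ n ∈ Finset.range N, (character (c n) X - m)‖ ^ 2 ∂μ : ℝ) : ℂ) =
      ((∑ i ∈ Finset.range N, ∑ j ∈ Finset.range N,
        Real.exp (-r ^ 2) * (Real.exp ⟪ξ i, ξ j⟫_ℝ - 1) : ℝ) : ℂ) := by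
    rw [← integral_complex_ofReal]
    have h1 : ∀ X, ((‖∑ n ∈ Finset.range N, (character (c n) X - m)‖ ^ 2 : ℝ) : ℂ) =
        ∑ i ∈ Finset.range N, ∑ j ∈ Finset.range N,
          (character (c i) X - m) * (starRingEnd ℂ) (character (c j) X - m) := by
      intro X
      rw [← Finset.sum_mul_sum, ← map_sum, Complex.mul_conj, Complex.normSq_eq_norm_sq]
    simp_rw [h1]
    rw [integral_finsetSum _ fun i _ => integrable_finsetSum _ fun j _ => hint i j]
    push_cast
    refine Finset.sum_congr rfl fun i _ => ?_
    rw [integral_finsetSum _ fun j _ => hint i j]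
    refine Finset.sum_congr rfl fun j _ => ?_
    rw [hpair]
    push_cast
    rfl
  rw [Complex.ofReal_inj.1 hsum]
  have hterm : ∀ i j, Real.exp (-r ^ 2) * (Real.exp ⟪ξ i, ξ j⟫_ℝ - 1) ≤
      (if i = j then 1 else 0) + ε := by
    intro i j
    have hε0 : 0 ≤ ε := (abs_nonneg _).trans (hε 0 1 (by norm_num))
    split_ifs with hij
    · subst hij
      rw [real_inner_self_eq_norm_sq, hr, mul_sub, ← Real.exp_add]
      have := Real.exp_pos (-r ^ 2)
      simp only [neg_add_cancel, Real.exp_zero]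
      linarith
    · have h1 : Real.exp (-r ^ 2) ≤ 1 := Real.exp_le_one_iff.2 (by nlinarith [sq_nonneg r])
      have h2 := (le_abs_self _).trans (hε i j hij)
      have h3 := Real.exp_pos (-r ^ 2)
      rw [zero_add]
      calc _ ≤ Real.exp (-r ^ 2) * ε := mul_le_mul_of_nonneg_left h2 h3.le
        _ ≤ 1 * ε := mul_le_mul_of_nonneg_right h1 hε0
        _ = ε := one_mul _
  calc _ ≤ ∑ i ∈ Finset.range N, ∑ j ∈ Finset.range N, ((if i = j then 1 else 0) + ε) :=
        Finset.sum_le_sum fun i _ => Finset.sum_le_sum fun j _ => hterm i j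
    _ = N + N ^ 2 * ε := by
        simp only [Finset.sum_add_distrib, Finset.sum_ite_eq, Finset.sum_const, Finset.card_range,
          nsmul_eq_mul]
        rw [Finset.sum_ite_of_true (fun i hi => hi)]
        simp
        ring

end GaussianProcess

end DeFinettiGroups

/-! ### Ergodicity and failure of the de Finetti property. -/

namespace DeFinettiGroups

open scoped InnerProductSpace

section GaussianProcess

variable {M : Type*} {H : Type*} [NormedAddCommGroup H] [InnerProductSpace ℝ H]

/-- A set is independent of a character as soon as it has the same correlation with arbitrarily
long sequences of almost uncorrelated characters. -/
theorem IsGaussianLaw.setIntegral_character_eq {v : M → H} {μ : Measure (M → ℝ)}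
    [IsProbabilityMeasure μ] (hμ : IsGaussianLaw v μ) {s : Set (M → ℝ)} (c₀ : M →₀ ℝ)
    (h : ∀ ε > 0, ∃ c : ℕ → M →₀ ℝ,
      (∀ n, ‖Finsupp.linearCombination ℝ v (c n)‖ = ‖Finsupp.linearCombination ℝ v c₀‖) ∧
      (∀ i j, i ≠ j → |Real.exp ⟪Finsupp.linearCombination ℝ v (c i),
        Finsupp.linearCombination ℝ v (c j)⟫_ℝ - 1| ≤ ε) ∧
      ∀ n, ∫ X in s, character (c n) X ∂μ = ∫ X in s, character c₀ X ∂μ) :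
    ∫ X in s, character c₀ X ∂μ = μ.real s * ∫ X, character c₀ X ∂μ := by
  set r := ‖Finsupp.linearCombination ℝ v c₀‖ with hr
  set m : ℝ := Real.exp (-r ^ 2 / 2) with hm
  set D : ℂ := ∫ X in s, (character c₀ X - m) ∂μ with hD
  have hDeq : ∀ c : M →₀ ℝ, ∫ X in s, (character c X - m) ∂μ =
      ∫ X in s, character c X ∂μ - μ.real s * m := by
    intro c
    rw [integral_sub (integrable_character c _) (integrable_const _), setIntegral_const,
      Complex.real_smul]
  rw [hμ c₀, ← hr, ← hm, ← sub_eq_zero, ← hDeq, ← hD, ← norm_le_zero_iff]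
  refine le_of_forall_pos_le_add fun η hη => ?_
  rw [zero_add]
  obtain ⟨N, hN⟩ := exists_nat_gt (2 / η ^ 2)
  have hN0 : (0 : ℝ) < N := lt_trans (by positivity) hN
  rw [div_lt_iff₀ (by positivity)] at hN
  -- With tolerance `1 / N` the sum of `N` centered characters has second moment at most `2 * N`,
  -- while its integral over `s` is `N * D`; hence `D` is of order `N ^ (-1 / 2)`.
  obtain ⟨c, hcr, hcε, hcs⟩ := h (1 / N) (by positivity)
  set F : (M → ℝ) → ℂ := fun X => ∑ n ∈ Finset.range N, (character (c n) X - m) with hF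
  have hterm : ∀ n, Integrable (fun X => character (c n) X - m) μ := fun n =>
    (integrable_character _ μ).sub (integrable_const _)
  have hFint : Integrable F μ := integrable_finsetSum _ fun n _ => hterm n
  have hFbound : ∀ X, ‖F X‖ ≤ N * (1 + |m|) := by
    intro X
    have : ∀ n ∈ Finset.range N, ‖character (c n) X - m‖ ≤ 1 + |m| := fun n _ => by
      refine (norm_sub_le _ _).trans ?_
      rw [norm_character, Complex.norm_real, Real.norm_eq_abs]
    refine (norm_sum_le_of_le _ this).trans_eq ?_
    rw [Finset.sum_const, Finset.card_range, nsmul_eq_mul]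
  have hF2 : Integrable (fun X => ‖F X‖ ^ 2) μ := by
    refine Integrable.of_bound (C := (N * (1 + |m|)) ^ 2)
      (hFint.aestronglyMeasurable.norm.pow 2) (ae_of_all _ fun X => ?_)
    rw [Real.norm_eq_abs, abs_of_nonneg (by positivity)]
    exact pow_le_pow_left₀ (norm_nonneg _) (hFbound X) 2
  have hFs : ∫ X in s, F X ∂μ = N * D := by
    rw [integral_finsetSum _ fun n _ => (hterm n).integrableOn]
    simp_rw [hDeq, hcs]
    rw [hD, hDeq, Finset.sum_const, Finset.card_range, nsmul_eq_mul]
  have h2 : ∫ X, ‖F X‖ ^ 2 ∂μ ≤ 2 * N := by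
    refine (hμ.integral_norm_sum_sq_le c N hcr hcε).trans_eq ?_
    field_simp
    ring
  -- The arithmetic–geometric mean inequality with weight `N * η`, in place of Cauchy–Schwarz for
  -- integrals.
  have hle : ∀ X, ‖F X‖ ≤ N * η / 2 + (2 * (N * η))⁻¹ * ‖F X‖ ^ 2 := by
    intro X
    have ht : 0 < N * η := by positivity
    have : N * η / 2 + (2 * (N * η))⁻¹ * ‖F X‖ ^ 2 - ‖F X‖ =
        (N * η - ‖F X‖) ^ 2 / (2 * (N * η)) := by
      field_simp
      ring
    have h3 : 0 ≤ (N * η - ‖F X‖) ^ 2 / (2 * (N * η)) := by positivity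
    linarith
  have h4 : N * ‖D‖ ≤ N * η := by
    calc N * ‖D‖ = ‖∫ X in s, F X ∂μ‖ := by rw [hFs, norm_mul, Complex.norm_natCast]
      _ ≤ ∫ X in s, ‖F X‖ ∂μ := norm_integral_le_integral_norm _
      _ ≤ ∫ X, ‖F X‖ ∂μ := setIntegral_le_integral hFint.norm (ae_of_all _ fun X => norm_nonneg _)
      _ ≤ ∫ X, (N * η / 2 + (2 * (N * η))⁻¹ * ‖F X‖ ^ 2) ∂μ :=
        integral_mono hFint.norm ((integrable_const _).add (hF2.const_mul _)) hle
      _ = N * η / 2 + (2 * (N * η))⁻¹ * ∫ X, ‖F X‖ ^ 2 ∂μ := by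
        rw [integral_add (integrable_const _) (hF2.const_mul _), integral_const_mul]
        simp
      _ ≤ N * η / 2 + (2 * (N * η))⁻¹ * (2 * N) := by gcongr
      _ ≤ N * η / 2 + N * η / 2 := by
        have : (2 * (N * η))⁻¹ * (2 * N) = 1 / η := by field_simp
        rw [this]
        have h5 : 1 / η ≤ N * η / 2 := by
          rw [div_le_iff₀ hη]
          nlinarith
        linarith
      _ = N * η := by ring
  exact le_of_mul_le_mul_left h4 hN0

theorem inner_linearCombination (v w : M → H) (c d : M →₀ ℝ) :
    ⟪Finsupp.linearCombination ℝ v c, Finsupp.linearCombination ℝ w d⟫_ℝ =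
      ∑ a ∈ c.support, ∑ b ∈ d.support, c a * (d b * ⟪v a, w b⟫_ℝ) := by
  simp only [Finsupp.linearCombination_apply, Finsupp.sum, sum_inner, inner_sum,
    real_inner_smul_left, real_inner_smul_right]
  rw [Finset.sum_comm]
  exact Finset.sum_congr rfl fun _ _ => Finset.sum_congr rfl fun _ _ => mul_left_comm _ _ _

end GaussianProcess

namespace IsHomogeneousSystem

variable {M : Type} {H : Type*} [NormedAddCommGroup H] [InnerProductSpace ℝ H] {T : Set ℝ}
  {v : M → H} {G : Subgroup (Equiv.Perm M)}

theorem norm_linearCombination_mapDomain (hv : IsHomogeneousSystem T v G) (g : G) (c : M →₀ ℝ) :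
    ‖Finsupp.linearCombination ℝ v (c.mapDomain (g • · : M → M))‖ =
      ‖Finsupp.linearCombination ℝ v c‖ := by
  rw [← sq_eq_sq₀ (norm_nonneg _) (norm_nonneg _), ← real_inner_self_eq_norm_sq,
    ← real_inner_self_eq_norm_sq, Finsupp.linearCombination_mapDomain, inner_linearCombination,
    inner_linearCombination]
  simp only [Function.comp, hv.inner_smul_smul]

/-- The translates of a finite linear combination contain almost orthogonal sequences. -/
theorem exists_almost_orthogonal (hv : IsHomogeneousSystem T v G) (c : M →₀ ℝ) {ε : ℝ}
    (hε : 0 < ε) : ∃ g : ℕ → G, ∀ i j, i ≠ j →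
      |⟪Finsupp.linearCombination ℝ v (c.mapDomain (g i • · : M → M)),
        Finsupp.linearCombination ℝ v (c.mapDomain (g j • · : M → M))⟫_ℝ| < ε := by
  classical
  obtain ⟨g, -, hg⟩ := exists_seq_of_forall_finset_exists (fun _ : G => True)
    (fun g h => |⟪Finsupp.linearCombination ℝ v (c.mapDomain (g • · : M → M)),
      Finsupp.linearCombination ℝ v (c.mapDomain (h • · : M → M))⟫_ℝ| < ε) (by
    intro F _
    set K := ∑ a ∈ c.support, ∑ b ∈ c.support, |c a| * |c b| with hK
    have hK0 : 0 ≤ K := Finset.sum_nonneg fun _ _ => Finset.sum_nonneg fun _ _ => by positivity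
    set δ := ε / (K + 1) with hδ
    have hδ0 : 0 < δ := by positivity
    -- A copy of the support of `c` almost orthogonal to all earlier translates; homogeneity
    -- realizes it by a group element.
    obtain ⟨φ, -, hφ, hφA⟩ := hv.exists_copy_near hv.linearIndependent hv.norm_eq hv.inner_mem
      (F.biUnion fun g => c.support.image (g • ·)) c.support δ hδ0
    obtain ⟨h, hhG, hh⟩ := hv.exists_perm c.support φ hφ
    refine ⟨⟨h, hhG⟩, trivial, fun g hg => ?_⟩
    rw [Finsupp.linearCombination_mapDomain, Finsupp.linearCombination_mapDomain,
      inner_linearCombination]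
    have hle : |∑ a ∈ c.support, ∑ b ∈ c.support, c a * (c b * ⟪v (g • a), v (h b)⟫_ℝ)|
        ≤ K * δ := by
      rw [hK, Finset.sum_mul]
      refine (Finset.abs_sum_le_sum_abs _ _).trans (Finset.sum_le_sum fun a ha => ?_)
      rw [Finset.sum_mul]
      refine (Finset.abs_sum_le_sum_abs _ _).trans (Finset.sum_le_sum fun b hb => ?_)
      rw [abs_mul, abs_mul, ← mul_assoc, hh b hb, real_inner_comm]
      refine mul_le_mul_of_nonneg_left ((hφA b hb).2 (g • a) ?_).le (by positivity)
      exact Finset.mem_biUnion.2 ⟨g, hg, Finset.mem_image_of_mem _ ha⟩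
    refine hle.trans_lt ?_
    have : δ * (K + 1) = ε := by rw [hδ]; field_simp
    nlinarith)
  refine ⟨g, fun i j hij => ?_⟩
  rcases lt_or_gt_of_ne hij with h | h
  · exact hg i j h
  · rw [real_inner_comm]
    exact hg j i h

theorem isShiftErgodic (hv : IsHomogeneousSystem T v G) {μ : Measure (M → ℝ)}
    [IsProbabilityMeasure μ] (hμ : IsGaussianLaw v μ) : IsShiftErgodic G μ := by
  let _ : MulAction G (M → ℝ) := arrowAction
  have hsmul : ∀ (g : G) (X : M → ℝ), g • X = fun a => X (g⁻¹ • a) := fun _ _ => rfl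
  have hmeas : ∀ g : G, Measurable fun X : M → ℝ => g • X := fun g => by
    simp only [hsmul]
    fun_prop
  have hch : ∀ (g : G) (c : M →₀ ℝ) (X : M → ℝ),
      character c (g • X) = character (c.mapDomain (g⁻¹ • · : M → M)) X := fun g c X => by
    rw [hsmul, character_comp]
  have hmap : ∀ g : G, μ.map (fun X : M → ℝ => g • X) = μ := by
    intro g
    have := Measure.isProbabilityMeasure_map (μ := μ) (hmeas g).aemeasurable
    refine ext_of_integral_character fun c => ?_
    rw [integral_map (hmeas g).aemeasurable (measurable_character c).aestronglyMeasurable]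
    simp_rw [hch]
    rw [hμ, hμ, hv.norm_linearCombination_mapDomain]
  have herg : ∀ s : Set (M → ℝ), MeasurableSet s →
      (∀ g : G, (fun X : M → ℝ => g • X) ⁻¹' s =ᵐ[μ] s) →
      Filter.EventuallyConst s (ae μ) := by
    intro s hs hinv
    have hset : ∀ (g : G) (c : M →₀ ℝ),
        ∫ X in s, character (c.mapDomain (g • · : M → M)) X ∂μ = ∫ X in s, character c X ∂μ := by
      intro g c
      conv_rhs => rw [← hmap g⁻¹]
      rw [setIntegral_map hs (measurable_character c).aestronglyMeasurable (hmeas _).aemeasurable,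
        setIntegral_congr_set (hinv g⁻¹)]
      simp_rw [hch, inv_inv]
    have hind : ∀ c : M →₀ ℝ,
        ∫ X in s, character c X ∂μ = μ.real s * ∫ X, character c X ∂μ := by
      intro c
      refine hμ.setIntegral_character_eq c fun ε hε => ?_
      obtain ⟨g, hg⟩ := hv.exists_almost_orthogonal c (ε := min 1 (ε / 2)) (by positivity)
      refine ⟨fun n => c.mapDomain (g n • · : M → M),
        fun n => hv.norm_linearCombination_mapDomain _ _, fun i j hij => ?_, fun n => hset _ _⟩
      have h1 := hg i j hij
      have h2 := Real.abs_exp_sub_one_le (h1.le.trans (min_le_left _ _))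
      linarith [h1.le.trans (min_le_right _ _)]
    -- Characters determine finite measures, so `s` is independent of every event, in particular of
    -- itself.
    have hrestrict : μ.restrict s = μ s • μ := by
      have : IsFiniteMeasure (μ s • μ) := Measure.smul_finite _ (measure_ne_top _ _)
      refine ext_of_integral_character fun c => ?_
      rw [hind c, integral_smul_measure, Complex.real_smul]
      rfl
    have hsq : μ s = μ s * μ s := by
      have := congrArg (fun ν : Measure (M → ℝ) => ν s) hrestrict
      simpa using this
    rw [Filter.eventuallyConst_set]
    by_cases h0 : μ s = 0
    · right
      exact measure_eq_zero_iff_ae_notMem.1 h0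
    · left
      have h1 : μ s = 1 := by
        have := (ENNReal.mul_right_inj h0 (measure_ne_top μ s) (b := μ s) (c := 1)).1
          (by rw [mul_one, ← hsq])
        exact this
      exact (prob_compl_eq_zero_iff hs).2 h1
  exact { measure_preimage_smul := fun g s hs => by
            rw [← Measure.map_apply (hmeas g) hs, hmap]
          aeconst_of_forall_preimage_smul_ae_eq := fun {s} => herg s }

/-- For a product measure, the characteristic function of `X x + X y` at `1` would be `exp (-1)`;
here it is `exp (-1 - t)` with a covariance `t > 0`. -/
theorem not_isDeFinetti [Countable M] (hv : IsHomogeneousSystem T v G)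
    (hT : ∀ t ∈ T, |t| < 1) : ¬ IsDeFinetti G := by
  classical
  intro h
  have := hv.infinite
  obtain ⟨μ, hprob, hμ⟩ := exists_isGaussianLaw hv.linearIndependent
  obtain ⟨ν, hν, hμν⟩ := h ℝ μ (hv.isShiftErgodic hμ)
  obtain ⟨x⟩ : Nonempty M := inferInstance
  obtain ⟨t, ht, ht2⟩ := hv.dense (1 / 2) (by rw [abs_of_pos] <;> norm_num) (1 / 4) (by norm_num)
  have ht0 : 0 < t := by linarith [(abs_lt.1 ht2).1]
  obtain ⟨y, hy⟩ := hv.exists_inner_eq_of_mem ht (hT t ht) x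
  have hxy : x ≠ y := by
    rintro rfl
    rw [real_inner_self_eq_norm_sq, hv.norm_eq] at hy
    have := hT t ht
    rw [← hy] at this
    norm_num at this
  have hone : ∀ z : M, ∫ X, character (Finsupp.single z 1) X ∂μ = charFun ν 1 := by
    intro z
    have hmz : μ.map (fun X => X z) = ν := by
      rw [hμν]
      exact Measure.infinitePi_map_eval (fun _ : M => ν) z
    rw [charFun_apply_real, ← hmz, integral_map (measurable_pi_apply z).aemeasurable
      (Measurable.aestronglyMeasurable (by fun_prop))]
    simp [character]
  have hind : ∫ X, character (Finsupp.single x 1 + Finsupp.single y 1) X ∂μ =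
      charFun ν 1 * charFun ν 1 := by
    have hF : ∀ X : M → ℝ, character (Finsupp.single x 1 + Finsupp.single y 1) X =
        (fun Y : ({x, y} : Finset M) → ℝ => ∏ i, Complex.exp ((1 : ℝ) * Y i * Complex.I))
          (({x, y} : Finset M).restrict X) := by
      intro X
      simp only [Finset.restrict]
      rw [Finset.prod_coe_sort ({x, y} : Finset M)
        (fun i => Complex.exp ((1 : ℝ) * X i * Complex.I)), Finset.prod_pair hxy,
        ← Complex.exp_add, character]
      simp [add_mul]
    simp_rw [hF]
    rw [hμν, integral_restrict_infinitePi (fun _ : M => ν)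
      (f := fun Y : ({x, y} : Finset M) → ℝ => ∏ i, Complex.exp ((1 : ℝ) * Y i * Complex.I))
      (Measurable.aestronglyMeasurable (by fun_prop)), integral_fintype_prod_eq_prod
      (f := fun (_ : ({x, y} : Finset M)) (r : ℝ) => Complex.exp ((1 : ℝ) * r * Complex.I))]
    simp_rw [← charFun_apply_real]
    rw [Finset.prod_const, Finset.card_univ, Fintype.card_coe, Finset.card_pair hxy, sq]
  rw [← hone x, hμ, hμ, map_add, Finsupp.linearCombination_single,
    Finsupp.linearCombination_single, one_smul, one_smul, ← Complex.ofReal_mul,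
    Complex.ofReal_inj, ← Real.exp_add, Real.exp_eq_exp, norm_add_sq_real, hv.norm_eq,
    hv.norm_eq, real_inner_comm, hy] at hind
  linarith

end IsHomogeneousSystem

end DeFinettiGroups

/-- For every countable dense `S ⊆ ℝ`, the finite spherical `S`-metric spaces form a Fraïssé class,
which has a Fraïssé limit, and every such limit is a countably infinite structure with the listed
properties. -/
theorem theorem2 (S : Set ℝ) (hS : Dense S) (hSc : S.Countable) :
    IsFraisse (DeFinettiGroups.sphericalClass S) ∧
    (∃ (M : Type) (_ : (DeFinettiGroups.distLanguage S).Structure M) (_ : Countable M),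
      IsFraisseLimit (DeFinettiGroups.sphericalClass S) M) ∧
    ∀ (M : Type) [(DeFinettiGroups.distLanguage S).Structure M] [Countable M],
      IsFraisseLimit (DeFinettiGroups.sphericalClass S) M →
        Infinite M ∧
        MulAction.IsPretransitive (DeFinettiGroups.autGroup (DeFinettiGroups.distLanguage S) M) M ∧
        DeFinettiGroups.NoAlgebraicity
          (DeFinettiGroups.autGroup (DeFinettiGroups.distLanguage S) M) ∧
        DeFinettiGroups.WeakEliminationOfImaginaries
          (DeFinettiGroups.autGroup (DeFinettiGroups.distLanguage S) M) ∧
        ¬ DeFinettiGroups.AlephZeroCategorical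
          (DeFinettiGroups.autGroup (DeFinettiGroups.distLanguage S) M) ∧
        ¬ DeFinettiGroups.IsDeFinetti
          (DeFinettiGroups.autGroup (DeFinettiGroups.distLanguage S) M) := by
  obtain ⟨_, v, hv, hg⟩ := DeFinettiGroups.exists_isFraisseLimit hS hSc
  have hlim := hg.isFraisseLimit hv
  refine ⟨hlim.isFraisse, ⟨ℕ, _, _, hlim⟩, fun M _ _ hM => ?_⟩
  obtain ⟨w, hw⟩ := DeFinettiGroups.exists_isHomogeneousSystem hS hSc hM
  exact ⟨hw.infinite, hw.isPretransitive, hw.noAlgebraicity, hw.weakEliminationOfImaginaries,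
    hw.not_alephZeroCategorical, hw.not_isDeFinetti fun t ht => ht.1⟩
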